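/- Let $p>2$ be an integer, let $\alpha,\beta\in\mathbb R$ with $0<2\alpha<1$ and $0<2\beta<1$, let $\lambda\in\mathbb C$, let $k_1,k_2,k_3,k_4\in\mathbb C$ be nonzero constants, and let $x_0=(x_{01},\dots,x_{0p})\in\mathbb R^p$ with $x_{01}>0$, $x_{02}>0$. For $x\in\mathbb R^p$, $x\ne x_0$, $x_1>0$, $x_2>0$, put $$r^2=\sum_{i=1}^p(x_i-x_{0i})^2,\quad r_1^2=(x_1+x_{01})^2+\sum_{i\ne 1}(x_i-x_{0i})^2,\quad r_2^2=(x_2+x_{02})^2+\sum_{i\neq 2}(x_i-x_{0i})^2,$$ $$\xi=\frac{r^2-r_1^2}{r^2}=-\frac{4x_1x_{01}}{r^2},\qquad \eta=\frac{r^2-r_2^2}{r^2}=-\frac{4x_2x_{02}}{r^2},\qquad \zeta=-\frac{\lambda^2}{4}r^2 .$$ Let $$A_2(a;b_1,b_2;c_1,c_2;x,y,z)=\sum_{m,n,k=0}^\infty\frac{(a)_{m+n-k}(b_1)_m(b_2)_n}{(c_1)_m(c_2)_n\,m!\,n!\,k!}x^my^nz^k,\qquad (a)_n=\frac{\Gamma(a+n)}{\Gamma(a)}\quad(|x|+|y|<1),$$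 and, for the other values of $(x,y)$ with $\operatorname{Re}x<\frac12$, $\operatorname{Re}y<\frac12$, let $A_2$ denote the holomorphic continuation of this series in $(x,y)$ (with $z$ fixed) to the domain $\{\operatorname{Re}x<\frac12,\ \operatorname{Re}y<\frac12\}\subset\mathbb C^2$. Put $$a_1=\alpha+\beta-1+\tfrac p2,\quad a_2=-\alpha+\beta+\tfrac p2,\quad a_3=\alpha-\beta+\tfrac p2,\quad a_4=1-\alpha-\beta+\tfrac p2,$$ and consider the four fundamental solutions $$q_1(x,x_0)=k_1(r^2)^{1-\alpha-\beta-\frac p2}A_2(a_1;\alpha,\beta;2\alpha,2\beta;\xi,\eta,\zeta),$$ $$q_2(x,x_0)=k_2(r^2)^{\alpha-\beta-\frac p2}x_1^{1-2\alpha}x_{01}^{1-2\alpha}A_2(a_2;1-\alpha,\beta;2-2\alpha,2\beta;\xi,\eta,\zeta),$$ $$q_3(x,x_0)=k_3(r^2)^{-\alpha+\beta-\frac p2}x_2^{1-2\beta}x_{02}^{1-2\beta}A_2(a_3;\alpha,1-\beta;2\alpha,2-2\beta;\xi,\eta,\zeta),$$ $$q_4(x,x_0)=k_4(r^2)^{-1+\alpha+\beta-\frac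 p2}x_1^{1-2\alpha}x_{01}^{1-2\alpha}x_2^{1-2\beta}x_{02}^{1-2\beta}A_2(a_4;1-\alpha,1-\beta;2-2\alpha,2-2\beta;\xi,\eta,\zeta)$$ of the equation $\sum_{i=1}^p u_{x_ix_i}+\frac{2\alpha}{x_1}u_{x_1}+\frac{2\beta}{x_2}u_{x_2}-\lambda^2u=0$ in $\{x_1>0,\ x_2>0\}$. Then for each $i\in\{1,2,3,4\}$ such that $\lambda=0$ or $a_i$ is not a positive integer (i.e. such that the coefficients $(a_i)_{m+n-k}$ that occur are defined), the above continuation of the function $A_2$ in the formula for $q_i$ exists for every value $z=-\lambda^2\rho^2/4$, $\rho\ge0$, and $q_i(\cdot,x_0)$ has a singularity of the exact order $1/r^{p-2}$ as $r\to0$: the limit $\lim_{x\to x_0}r^{p-2}q_i(x,x_0)$ exists and is finite and nonzero. -/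

import Mathlib

open Filter Topology

noncomputable section

/-! ### The confluent hypergeometric function `A₂` of three variables -/

/-- The Pochhammer symbol `(a)_n = Γ(a + n) / Γ(a)` with an integer (possibly negative) index. -/
def pochhammerInt (a : ℂ) (n : ℤ) : ℂ := Complex.Gamma (a + n) / Complex.Gamma a

/-- The term of index `(m, n, k)` of the triple power series
`A₂(a; b₁, b₂; c₁, c₂; x, y, z) =
  ∑ (a)_{m+n-k} (b₁)_m (b₂)_n / ((c₁)_m (c₂)_n m! n! k!) x^m y^n z^k`. -/
def seriesTermA2 (a b₁ b₂ c₁ c₂ x y z : ℂ) (i : ℕ × ℕ × ℕ) : ℂ :=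
  pochhammerInt a ((i.1 : ℤ) + i.2.1 - i.2.2) * pochhammerInt b₁ i.1 * pochhammerInt b₂ i.2.1 /
      (pochhammerInt c₁ i.1 * pochhammerInt c₂ i.2.1 *
        (i.1.factorial : ℂ) * (i.2.1.factorial : ℂ) * (i.2.2.factorial : ℂ)) *
    x ^ i.1 * y ^ i.2.1 * z ^ i.2.2

/-- The open convex domain `{Re x < 1/2, Re y < 1/2}` of `ℂ²`. It contains the origin and all
points with `x ≤ 0` and `y ≤ 0` real. -/
def domainA2 : Set (ℂ × ℂ) := {w | w.1.re < 1 / 2 ∧ w.2.re < 1 / 2}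

/-- `f` is, for the given value of `z`, the analytic continuation in `(x, y)` of the series of
`A₂( · , · , z)`: it is holomorphic on the domain `{Re x < 1/2, Re y < 1/2}`, and there it is the
sum of the series wherever `|x| + |y| < 1`. -/
structure IsContinuationA2 (a b₁ b₂ c₁ c₂ z : ℂ) (f : ℂ × ℂ → ℂ) : Prop where
  holomorphic : DifferentiableOn ℂ f domainA2
  hasSum : ∀ w ∈ domainA2, ‖w.1‖ + ‖w.2‖ < 1 →
    HasSum (seriesTermA2 a b₁ b₂ c₁ c₂ w.1 w.2 z) (f w)

/-- The analytic continuation is unique. -/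
theorem IsContinuationA2.eqOn {a b₁ b₂ c₁ c₂ z : ℂ} {f g : ℂ × ℂ → ℂ}
    (hf : IsContinuationA2 a b₁ b₂ c₁ c₂ z f) (hg : IsContinuationA2 a b₁ b₂ c₁ c₂ z g) :
    Set.EqOn f g domainA2 := by
  intro w hw
  have hopen : IsOpen domainA2 := by
    have h1 : IsOpen {w : ℂ × ℂ | w.1.re < 1 / 2} :=
      isOpen_lt (Complex.continuous_re.comp continuous_fst) continuous_const
    have h2 : IsOpen {w : ℂ × ℂ | w.2.re < 1 / 2} :=
      isOpen_lt (Complex.continuous_re.comp continuous_snd) continuous_const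
    exact h1.inter h2
  have hconv : Convex ℝ domainA2 := by
    intro u hu v hv s t hs ht hst
    simp only [domainA2, Set.mem_ofPred_eq, Prod.fst_add, Prod.snd_add, Prod.smul_fst,
      Prod.smul_snd, Complex.add_re, Complex.real_smul, Complex.re_ofReal_mul] at *
    have h : t = 1 - s := by linarith
    subst h
    rcases hs.eq_or_lt with rfl | hs
    · constructor <;> linarith
    · constructor <;> nlinarith
  let l : ℂ →L[ℂ] ℂ × ℂ := ContinuousLinearMap.toSpanSingleton ℂ w
  have hl : ∀ t, l t = t • w := fun t => by simp [l]
  let S : Set ℂ := l ⁻¹' domainA2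
  have hS : IsOpen S := hopen.preimage l.continuous
  have hSc : Convex ℝ S := hconv.linear_preimage (l.restrictScalars ℝ).toLinearMap
  have key : ∀ h : ℂ × ℂ → ℂ, DifferentiableOn ℂ h domainA2 →
      AnalyticOnNhd ℂ (fun t => h (l t)) S := fun h hh =>
    (hh.comp l.differentiable.differentiableOn (fun t ht => ht)).analyticOnNhd hS
  have h0 : (0 : ℂ) ∈ S := by
    change l 0 ∈ domainA2
    simp [domainA2]
  have h1 : (1 : ℂ) ∈ S := by
    change l 1 ∈ domainA2
    simpa [hl] using hw
  have hnear : (fun t => f (l t)) =ᶠ[𝓝 0] fun t => g (l t) := by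
    have hc : ∀ᶠ t in 𝓝 (0 : ℂ), ‖(l t).1‖ + ‖(l t).2‖ < 1 := by
      have : Continuous fun t => ‖(l t).1‖ + ‖(l t).2‖ := by fun_prop
      exact this.continuousAt.eventually_lt continuousAt_const (by simp)
    filter_upwards [hc, hS.mem_nhds h0] with t ht hts
    exact (hf.hasSum _ hts ht).unique (hg.hasSum _ hts ht)
  have := (key f hf.holomorphic).eqOn_of_preconnected_of_eventuallyEq
    (key g hg.holomorphic) hSc.isPreconnected h0 hnear h1
  simpa [hl] using this

open Classical in
/-- The function `A₂(a; b₁, b₂; c₁, c₂; x, y, z)` for `Re x < 1/2`, `Re y < 1/2`: the value of the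
analytic continuation of its power series (and `0` should there be no continuation). -/
def hypergeometricA2 (a b₁ b₂ c₁ c₂ x y z : ℂ) : ℂ :=
  if h : ∃ f, IsContinuationA2 a b₁ b₂ c₁ c₂ z f then h.choose (x, y) else 0

/-! ### Distances and the variables `ξ`, `η`, `ζ` -/

/-- `r² = ∑ (x_i - x_{0i})²`. -/
def rSq {p : ℕ} (x x₀ : EuclideanSpace ℝ (Fin p)) : ℝ := ∑ i, (x i - x₀ i) ^ 2

/-- `(x_j + x_{0j})² + ∑_{i ≠ j} (x_i - x_{0i})²`: this is `r₁²` for the first coordinate `j` and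
`r₂²` for the second one. -/
def reflectedRSq {p : ℕ} (j : Fin p) (x x₀ : EuclideanSpace ℝ (Fin p)) : ℝ :=
  (x j + x₀ j) ^ 2 + ∑ i ∈ Finset.univ.erase j, (x i - x₀ i) ^ 2

/-- `(r² - r_j²) / r²`: this is `ξ` for the first coordinate and `η` for the second one. -/
def ratioVar {p : ℕ} (j : Fin p) (x x₀ : EuclideanSpace ℝ (Fin p)) : ℝ :=
  (rSq x x₀ - reflectedRSq j x x₀) / rSq x x₀

/-- `ζ = -(λ² / 4) r²`. -/
def zetaVar {p : ℕ} (lam : ℂ) (x x₀ : EuclideanSpace ℝ (Fin p)) : ℂ := -(lam ^ 2 / 4) * rSq x x₀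

/-- The index of the coordinate `x₁`. -/
def ix1 {p : ℕ} (hp : 2 < p) : Fin p := ⟨0, by omega⟩

/-- The index of the coordinate `x₂`. -/
def ix2 {p : ℕ} (hp : 2 < p) : Fin p := ⟨1, by omega⟩

/-- The value of `A₂(a; b₁, b₂; c₁, c₂; ξ, η, ζ)`, with real parameters. -/
def A2xi {p : ℕ} (hp : 2 < p) (lam : ℂ) (a b₁ b₂ c₁ c₂ : ℝ)
    (x x₀ : EuclideanSpace ℝ (Fin p)) : ℂ :=
  hypergeometricA2 a b₁ b₂ c₁ c₂ (ratioVar (ix1 hp) x x₀) (ratioVar (ix2 hp) x x₀)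
    (zetaVar lam x x₀)

/-! ### The four fundamental solutions -/

/-- `q₁(x, x₀)`. -/
def fundSol1 {p : ℕ} (hp : 2 < p) (α β : ℝ) (lam k : ℂ) (x x₀ : EuclideanSpace ℝ (Fin p)) : ℂ :=
  k * (rSq x x₀ ^ (1 - α - β - (p : ℝ) / 2) : ℝ) *
    A2xi hp lam (α + β - 1 + (p : ℝ) / 2) α β (2 * α) (2 * β) x x₀

/-- `q₂(x, x₀)`. -/
def fundSol2 {p : ℕ} (hp : 2 < p) (α β : ℝ) (lam k : ℂ) (x x₀ : EuclideanSpace ℝ (Fin p)) : ℂ :=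
  k * (rSq x x₀ ^ (α - β - (p : ℝ) / 2) *
      x (ix1 hp) ^ (1 - 2 * α) * x₀ (ix1 hp) ^ (1 - 2 * α) : ℝ) *
    A2xi hp lam (-α + β + (p : ℝ) / 2) (1 - α) β (2 - 2 * α) (2 * β) x x₀

/-- `q₃(x, x₀)`. -/
def fundSol3 {p : ℕ} (hp : 2 < p) (α β : ℝ) (lam k : ℂ) (x x₀ : EuclideanSpace ℝ (Fin p)) : ℂ :=
  k * (rSq x x₀ ^ (-α + β - (p : ℝ) / 2) *
      x (ix2 hp) ^ (1 - 2 * β) * x₀ (ix2 hp) ^ (1 - 2 * β) : ℝ) *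
    A2xi hp lam (α - β + (p : ℝ) / 2) α (1 - β) (2 * α) (2 - 2 * β) x x₀

/-- `q₄(x, x₀)`. -/
def fundSol4 {p : ℕ} (hp : 2 < p) (α β : ℝ) (lam k : ℂ) (x x₀ : EuclideanSpace ℝ (Fin p)) : ℂ :=
  k * (rSq x x₀ ^ (-1 + α + β - (p : ℝ) / 2) *
      x (ix1 hp) ^ (1 - 2 * α) * x₀ (ix1 hp) ^ (1 - 2 * α) *
      x (ix2 hp) ^ (1 - 2 * β) * x₀ (ix2 hp) ^ (1 - 2 * β) : ℝ) *
    A2xi hp lam (1 - α - β + (p : ℝ) / 2) (1 - α) (1 - β) (2 - 2 * α) (2 - 2 * β) x x₀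

/-- `A₂(a; b₁, b₂; c₁, c₂; · , · , ζ)` is well defined by analytic continuation for all the values
`ζ = -(λ² / 4) r²`. -/
def A2WellDefined (p : ℕ) (lam : ℂ) (a b₁ b₂ c₁ c₂ : ℝ) : Prop :=
  ∀ x x₀ : EuclideanSpace ℝ (Fin p),
    IsContinuationA2 a b₁ b₂ c₁ c₂ (zetaVar lam x x₀)
      (fun w => hypergeometricA2 a b₁ b₂ c₁ c₂ w.1 w.2 (zetaVar lam x x₀))

/-- `u` has at `x₀` a singularity of the exact order `1 / r^m`, where `r = |x - x₀|`:
the product `r^m u(x)` has a finite nonzero limit as `r → 0`. -/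
def HasSingularityOfOrder {p : ℕ} (u : EuclideanSpace ℝ (Fin p) → ℂ)
    (x₀ : EuclideanSpace ℝ (Fin p)) (m : ℕ) : Prop :=
  ∃ L : ℂ, L ≠ 0 ∧ Tendsto (fun x => ((dist x x₀ ^ m : ℝ) : ℂ) * u x) (𝓝[≠] x₀) (𝓝 L)

end

/-!
All four fundamental solutions have the same shape. With `b₁ ∈ {α, 1 - α}` and `b₂ ∈ {β, 1 - β}`
one has `c₁ = 2 b₁`, `c₂ = 2 b₂` and `a = b₁ + b₂ - 1 + p / 2`, and the power of `r²` in front is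
`(r²)^(-a)`; the remaining factors have a positive limit at `x₀`. As
`r^(p-2) (r²)^(-a) = (r²)^(-(b₁+b₂))`, the claim is that `A₂` is defined by continuation and is of
the exact order `(r²)^(b₁+b₂)`.

*Continuation.* The rule `(a)_{m+n-k} = (a)_{-k} (a-k)_{m+n}` and the binomial series turn the
factor of the series without the `bᵢ` and `cᵢ` into the kernel `w^(-a) Φ(z w)` at `w = 1 - x - y`,
where `Φ(s) = ∑ (a)_{-k} s^k / k!` is entire (`hasSum_seriesTermKernelA2`). The quotient
`(b)_m / (2b)_m` is the `m`-th moment of the beta distribution with parameters `(b, b)`. So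
`A₂(x, y, z)` is the average of the kernel at `w = 1 - x u - y v` over independent beta variables
`u`, `v`. For `Re x, Re y < 1/2` the point `w` has positive real part, and the average is
holomorphic in `(x, y)`: it is the continuation (`isContinuationA2_integralA2`).

*Order of the singularity.* Put `ρ = r²`, `ξ = -A / ρ`, `η = -B / ρ`, with `A` and `B` tending to
positive limits. Then `ρ w` stays bounded, so `|Φ(ζ w) - 1| ≤ K (ρ w)^θ` for every `0 < θ < 1`.
This reduces `A₂` to the average of `(1 + X u + Y v)^(-a)` with `X = A / ρ`, `Y = B / ρ`, up to
`ρ^θ` times the same average with exponent `a - θ`. Writing the power as a gamma integral, this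
average becomes
`1 / Γ(a) ∫ t^(a-1) e^(-t) M₁(X t) M₂(Y t) dt` with the Laplace transforms `M₁`, `M₂` of the beta
distributions (`powerAverage_eq_integral_laplaceBeta`). As `x^b M(x)` is bounded and tends to a
positive limit (`tendsto_rpow_mul_laplaceBeta`), dominated convergence gives the exact order
`X^(-b₁) Y^(-b₂)` for every exponent larger than `b₁ + b₂` (`tendsto_rpow_mul_powerAverage`). The
exponent `a` is larger than `b₁ + b₂` because `p > 2`, and `a - θ` is so for small `θ`.
-/

noncomputable section

open MeasureTheory ProbabilityTheory Set

/-! ### The binomial series in two variables -/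

theorem ringChoose_add_sub_one_eq_ascPochhammer_div {K : Type*} [Field K] [CharZero K]
    [BinomialRing K] (c : K) (n : ℕ) :
    Ring.choose (c + n - 1) n = (ascPochhammer K n).eval c / (n.factorial : K) := by
  have h := Ring.factorial_nsmul_multichoose_eq_ascPochhammer c n
  rw [Polynomial.ascPochhammer_smeval_eq_eval, nsmul_eq_mul] at h
  rw [← h, Ring.choose]
  have : c + n - 1 - n + 1 = c := by ring
  rw [this, mul_div_cancel_left₀]
  exact_mod_cast n.factorial_ne_zero

theorem Complex.hasSum_ascPochhammer_mul_pow (c : ℂ) {s : ℂ} (hs : ‖s‖ < 1) :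
    HasSum (fun n : ℕ => (ascPochhammer ℂ n).eval c / (n.factorial : ℂ) * s ^ n)
      (1 / (1 - s) ^ c) := by
  have h := (Complex.one_div_one_sub_cpow_hasFPowerSeriesOnBall_zero c).hasSum (y := s)
    (by simpa [enorm_eq_nnnorm, ← NNReal.coe_lt_one] using hs)
  simpa [FormalMultilinearSeries.ofScalars_apply_eq, zero_add,
    ringChoose_add_sub_one_eq_ascPochhammer_div, mul_comm] using h

theorem Real.hasSum_ascPochhammer_mul_pow (c : ℝ) {s : ℝ} (hs : ‖s‖ < 1) :
    HasSum (fun n : ℕ => (ascPochhammer ℝ n).eval c / (n.factorial : ℝ) * s ^ n)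
      (1 / (1 - s) ^ c) := by
  have h := (Real.one_div_one_sub_rpow_hasFPowerSeriesOnBall_zero c).hasSum (y := s)
    (by simpa [enorm_eq_nnnorm, ← NNReal.coe_lt_one] using hs)
  simpa [FormalMultilinearSeries.ofScalars_apply_eq, zero_add,
    ringChoose_add_sub_one_eq_ascPochhammer_div, mul_comm] using h

theorem norm_eval_ascPochhammer_le (c : ℂ) {r : ℝ} (hr : ‖c‖ ≤ r) (n : ℕ) :
    ‖(ascPochhammer ℂ n).eval c‖ ≤ (ascPochhammer ℝ n).eval r := by
  induction n with
  | zero => simp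
  | succ n ih =>
    rw [ascPochhammer_succ_eval, ascPochhammer_succ_eval, norm_mul]
    refine mul_le_mul ih ((norm_add_le _ _).trans ?_) (norm_nonneg _) ((norm_nonneg _).trans ih)
    simpa using hr

theorem sum_antidiagonal_mul_pow_div_factorial {K : Type*} [Field K] [CharZero K]
    (C : ℕ → K) (x y : K) (n : ℕ) :
    ∑ q ∈ Finset.HasAntidiagonal.antidiagonal n,
      C (q.1 + q.2) / ((q.1.factorial : K) * (q.2.factorial : K)) * (x ^ q.1 * y ^ q.2) =
        C n / (n.factorial : K) * (x + y) ^ n := by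
  rw [(Commute.all x y).add_pow', Finset.mul_sum]
  refine Finset.sum_congr rfl fun q hq => ?_
  rw [Finset.HasAntidiagonal.mem_antidiagonal] at hq
  subst hq
  have h := Nat.add_choose_mul_factorial_mul_factorial q.1 q.2
  have h' : ((q.1 + q.2).choose q.1 : K) * q.1.factorial * q.2.factorial =
    (q.1 + q.2).factorial := by
    rw [Nat.choose_symm_add]
    exact_mod_cast h
  have h1 : (q.1.factorial : K) ≠ 0 := by exact_mod_cast q.1.factorial_ne_zero
  have h2 : (q.2.factorial : K) ≠ 0 := by exact_mod_cast q.2.factorial_ne_zero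
  have h3 : ((q.1 + q.2).choose q.1 : K) ≠ 0 := by
    exact_mod_cast (Nat.choose_pos (Nat.le_add_right _ _)).ne'
  rw [nsmul_eq_mul, ← h']
  field_simp

/-- Grouping a double power series by total degree. -/
theorem hasSum_prod_of_hasSum_antidiagonal {K : Type*} [RCLike K]
    {C : ℕ → K} {x y s : K}
    (hsum : Summable fun q : ℕ × ℕ =>
      C (q.1 + q.2) / ((q.1.factorial : K) * (q.2.factorial : K)) * (x ^ q.1 * y ^ q.2))
    (h : HasSum (fun n : ℕ => C n / (n.factorial : K) * (x + y) ^ n) s) :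
    HasSum (fun q : ℕ × ℕ =>
      C (q.1 + q.2) / ((q.1.factorial : K) * (q.2.factorial : K)) * (x ^ q.1 * y ^ q.2)) s := by
  let e := Finset.HasAntidiagonal.sigmaAntidiagonalEquivProd (A := ℕ)
  have h1 := (e.hasSum_iff.2 hsum.hasSum).sigma
    (g := fun n : ℕ => C n / (n.factorial : K) * (x + y) ^ n) fun n => by
      rw [← sum_antidiagonal_mul_pow_div_factorial, ← Finset.sum_finset_coe]
      exact hasSum_fintype (fun q : Finset.HasAntidiagonal.antidiagonal n => _)
  rw [h.unique h1]
  exact hsum.hasSum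

theorem hasSum_ascPochhammer_prod_of_nonneg {r x y : ℝ} (hr : 0 ≤ r) (hx : 0 ≤ x) (hy : 0 ≤ y)
    (hxy : x + y < 1) :
    HasSum (fun q : ℕ × ℕ => (ascPochhammer ℝ (q.1 + q.2)).eval r /
      ((q.1.factorial : ℝ) * (q.2.factorial : ℝ)) * (x ^ q.1 * y ^ q.2))
      (1 / (1 - (x + y)) ^ r) := by
  have hs : ‖x + y‖ < 1 := by rwa [Real.norm_of_nonneg (by positivity)]
  have h := Real.hasSum_ascPochhammer_mul_pow r hs
  have hpos : ∀ n, 0 ≤ (ascPochhammer ℝ n).eval r := fun n =>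
    (norm_nonneg _).trans (norm_eval_ascPochhammer_le (r : ℂ) (by simp [abs_of_nonneg hr]) n)
  refine hasSum_prod_of_hasSum_antidiagonal (C := fun n => (ascPochhammer ℝ n).eval r) ?_ h
  let e := Finset.HasAntidiagonal.sigmaAntidiagonalEquivProd (A := ℕ)
  rw [← e.summable_iff, summable_sigma_of_nonneg]
  · refine ⟨fun n => (hasSum_fintype _).summable, ?_⟩
    convert h.summable using 2 with n
    rw [← sum_antidiagonal_mul_pow_div_factorial (fun n => (ascPochhammer ℝ n).eval r),
      ← Finset.sum_finset_coe, tsum_fintype]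
    rfl
  · intro q
    have := hpos ((e q).1 + (e q).2)
    simp only [Function.comp]
    positivity

theorem Complex.hasSum_ascPochhammer_prod (c : ℂ) {x y : ℂ} (hxy : ‖x‖ + ‖y‖ < 1) :
    HasSum (fun q : ℕ × ℕ => (ascPochhammer ℂ (q.1 + q.2)).eval c /
      ((q.1.factorial : ℂ) * (q.2.factorial : ℂ)) * (x ^ q.1 * y ^ q.2))
      (1 / (1 - (x + y)) ^ c) := by
  refine hasSum_prod_of_hasSum_antidiagonal (C := fun n => (ascPochhammer ℂ n).eval c) ?_
    (Complex.hasSum_ascPochhammer_mul_pow c ((norm_add_le _ _).trans_lt hxy))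
  refine Summable.of_norm_bounded (hasSum_ascPochhammer_prod_of_nonneg (norm_nonneg c)
    (norm_nonneg x) (norm_nonneg y) hxy).summable fun q => ?_
  simp only [norm_mul, norm_div, norm_pow, Complex.norm_natCast]
  gcongr
  exact norm_eval_ascPochhammer_le c le_rfl _

/-! ### The kernel of the integral representation -/

/-- The coefficient `(a)_{-k} / k!` of the confluent factor. -/
def confluentCoeff (a : ℂ) (k : ℕ) : ℂ := pochhammerInt a (-(k : ℤ)) / (k.factorial : ℂ)

/-- The entire function `∑ (a)_{-k} s^k / k!`, which is `₀F₁(; 1 - a; -s)` when `a` is not a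
positive integer. For a positive integer `a` the coefficients at the poles of `Γ` are `0`, so the
sum is a polynomial. -/
def confluentFun (a s : ℂ) : ℂ := ∑' k : ℕ, confluentCoeff a k * s ^ k

/-- The function `w ^ (-a) ∑ (a)_{-k} (z w)^k / k!`: evaluated at `w = 1 - x u - y v` and averaged
over `u` and `v` it gives the function `A₂` at `(x, y, z)`. -/
def kernelA2 (a z w : ℂ) : ℂ := w ^ (-a) * confluentFun a (z * w)

/-- The ratio of consecutive coefficients is `1 / ((a - k - 1) (k + 1))`. -/
theorem norm_confluentCoeff_succ_le (a : ℂ) {k : ℕ} (hk : ‖a‖ + 1 ≤ k + 1) :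
    ‖confluentCoeff a (k + 1)‖ ≤ ‖confluentCoeff a k‖ / (k + 1) := by
  have h1 : 1 ≤ ‖a - (k + 1)‖ := by
    have := norm_sub_norm_le ((k : ℂ) + 1) a
    rw [norm_sub_rev] at this
    have h2 : ‖(k : ℂ) + 1‖ = k + 1 := by exact_mod_cast Complex.norm_natCast (k + 1)
    linarith
  have h0 : a - (k + 1) ≠ 0 := norm_pos_iff.1 (by linarith)
  have hG : Complex.Gamma (a - k) = (a - (k + 1)) * Complex.Gamma (a - (k + 1)) := by
    rw [← Complex.Gamma_add_one _ h0]
    ring_nf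
  have e : confluentCoeff a k = (a - (k + 1)) * confluentCoeff a (k + 1) * (k + 1) := by
    have hf : (k.factorial : ℂ) ≠ 0 := by exact_mod_cast k.factorial_ne_zero
    have hk' : (k : ℂ) + 1 ≠ 0 := by exact_mod_cast k.succ_ne_zero
    simp only [confluentCoeff, pochhammerInt, Nat.factorial_succ]
    push_cast
    rw [← sub_eq_add_neg, hG, ← sub_eq_add_neg]
    field_simp
  have hk' : ‖(k : ℂ) + 1‖ = k + 1 := by exact_mod_cast Complex.norm_natCast (k + 1)
  rw [e, norm_mul, norm_mul, hk', mul_div_cancel_right₀ _ (by positivity)]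
  nlinarith [norm_nonneg (confluentCoeff a (k + 1))]

theorem summable_norm_confluentCoeff_mul_pow (a s : ℂ) :
    Summable fun k : ℕ => ‖confluentCoeff a k * s ^ k‖ := by
  refine summable_of_ratio_norm_eventually_le (r := 1 / 2) (by norm_num) ?_
  filter_upwards [eventually_ge_atTop ⌈‖a‖⌉₊, eventually_ge_atTop ⌈2 * ‖s‖⌉₊] with k hk1 hk2
  have h1 : ‖a‖ ≤ k := Nat.ceil_le.1 hk1
  have h2 : 2 * ‖s‖ ≤ k := Nat.ceil_le.1 hk2
  have h3 := norm_confluentCoeff_succ_le a (k := k) (by linarith)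
  simp only [norm_norm, norm_mul, norm_pow, pow_succ]
  have h4 : ‖s‖ / (k + 1) ≤ 1 / 2 := by
    rw [div_le_iff₀ (by positivity)]
    linarith
  calc _ ≤ ‖confluentCoeff a k‖ / (k + 1) * (‖s‖ ^ k * ‖s‖) := by gcongr
    _ = ‖confluentCoeff a k‖ * ‖s‖ ^ k * (‖s‖ / (k + 1)) := by ring
    _ ≤ ‖confluentCoeff a k‖ * ‖s‖ ^ k * (1 / 2) := by gcongr
    _ = _ := by ring

theorem hasSum_confluentFun (a s : ℂ) :
    HasSum (fun k : ℕ => confluentCoeff a k * s ^ k) (confluentFun a s) :=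
  (summable_norm_confluentCoeff_mul_pow a s).of_norm.hasSum

theorem differentiable_confluentFun (a : ℂ) : Differentiable ℂ (confluentFun a) := by
  intro s
  have h := Complex.differentiableOn_tsum_of_summable_norm (F := fun (k : ℕ) (s : ℂ) =>
    confluentCoeff a k * s ^ k) (U := Metric.ball 0 (‖s‖ + 1))
    (summable_norm_confluentCoeff_mul_pow a ((‖s‖ + 1 : ℝ) : ℂ)) (fun k => by fun_prop)
    Metric.isOpen_ball (fun k w hw => by
      have : ‖w‖ ≤ ‖s‖ + 1 := by simpa using (mem_ball_zero_iff.1 hw).le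
      rw [norm_mul, norm_mul, norm_pow, norm_pow, Complex.norm_real,
        Real.norm_of_nonneg (by positivity)]
      gcongr)
  exact h.differentiableAt (Metric.isOpen_ball.mem_nhds (by simp))

theorem confluentFun_zero {a : ℂ} (ha : Complex.Gamma a ≠ 0) : confluentFun a 0 = 1 := by
  rw [confluentFun, tsum_eq_single 0 (fun k hk => by simp [hk])]
  simp [confluentCoeff, pochhammerInt, ha]

theorem exists_norm_confluentFun_sub_one_le {a : ℂ} (ha : Complex.Gamma a ≠ 0) (R : ℝ) :
    ∃ K, 0 ≤ K ∧ ∀ s, ‖s‖ ≤ R → ‖confluentFun a s - 1‖ ≤ K * ‖s‖ := by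
  have hc : Continuous (deriv (confluentFun a)) :=
    ((differentiable_confluentFun a).contDiff (n := 1)).continuous_deriv le_rfl
  obtain ⟨K, hK⟩ := (isCompact_closedBall (0 : ℂ) R).exists_bound_of_continuousOn hc.continuousOn
  refine ⟨max K 0, le_max_right _ _, fun s hs => ?_⟩
  have hR : 0 ≤ R := (norm_nonneg s).trans hs
  have h := (convex_closedBall (0 : ℂ) R).norm_image_sub_le_of_norm_deriv_le
    (f := confluentFun a) (x := 0) (y := s) (C := max K 0)
    (fun w _ => (differentiable_confluentFun a) w)
    (fun w hw => (hK w hw).trans (le_max_left _ _)) (by simpa using hR) (by simpa using hs)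
  rwa [confluentFun_zero ha, sub_zero] at h

theorem differentiableOn_kernelA2 (a z : ℂ) :
    DifferentiableOn ℂ (kernelA2 a z) {w | 0 < w.re} := by
  intro w hw
  refine DifferentiableAt.differentiableWithinAt ?_
  refine DifferentiableAt.mul ?_ ?_
  · exact differentiableAt_id.cpow_const (Or.inl hw)
  · exact (differentiable_confluentFun a).differentiableAt.comp w (by fun_prop)

/-! ### The triple series of the kernel -/

theorem Gamma_add_natCast_eq_ascPochhammer_mul {c : ℂ} (hc : ∀ i : ℕ, c + i ≠ 0) (j : ℕ) :
    Complex.Gamma (c + j) = (ascPochhammer ℂ j).eval c * Complex.Gamma c := by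
  induction j with
  | zero => simp
  | succ j ih =>
    rw [ascPochhammer_succ_eval, Nat.cast_succ, ← add_assoc, Complex.Gamma_add_one _ (hc j), ih]
    ring

/-- The rule `(a)_{j-k} = (a)_{-k} (a-k)_j`, whose only exceptions are multiplied by `z ^ k = 0`. -/
theorem pochhammerInt_sub_mul_pow {a : ℝ} (ha : 0 < a) {z : ℂ}
    (h : z = 0 ∨ ∀ n : ℕ, 1 ≤ n → a ≠ n) (j k : ℕ) :
    pochhammerInt a ((j : ℤ) - k) / (k.factorial : ℂ) * z ^ k =
      confluentCoeff a k * z ^ k * (ascPochhammer ℂ j).eval ((a : ℂ) - k) := by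
  have key : (∀ i : ℕ, (a : ℂ) - k + i ≠ 0) → pochhammerInt a ((j : ℤ) - k) =
      pochhammerInt a (-(k : ℤ)) * (ascPochhammer ℂ j).eval ((a : ℂ) - k) := by
    intro hc
    have := Gamma_add_natCast_eq_ascPochhammer_mul hc j
    simp only [pochhammerInt]
    push_cast
    rw [← sub_eq_add_neg, show (a : ℂ) + (j - k) = a - k + j by ring, this]
    ring
  by_cases hz : z ^ k = 0
  · simp [hz]
  rw [key, confluentCoeff]
  · ring
  intro i hi
  have hi' : a - k + i = 0 := by exact_mod_cast hi
  rcases h with rfl | h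
  · have hk : k = 0 := by
      by_contra hk
      exact hz (zero_pow hk)
    subst hk
    have : (0 : ℝ) ≤ i := i.cast_nonneg
    push_cast at hi'
    linarith
  · have hik : i < k := by
      have : (i : ℝ) < k := by linarith
      exact_mod_cast this
    refine h (k - i) (by omega) ?_
    rw [Nat.cast_sub hik.le]
    linarith

/-- The term of the triple power series of `(x, y, z) ↦ kernelA2 a z (1 - x - y)`. -/
def seriesTermKernelA2 (a x y z : ℂ) (i : ℕ × ℕ × ℕ) : ℂ :=
  pochhammerInt a ((i.1 : ℤ) + i.2.1 - i.2.2) /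
    ((i.1.factorial : ℂ) * (i.2.1.factorial : ℂ) * (i.2.2.factorial : ℂ)) *
      x ^ i.1 * y ^ i.2.1 * z ^ i.2.2

/-- The index order `(k, (m, n))`, in which the series is summed over `m` and `n` first. -/
def tripleIndexEquiv : ℕ × (ℕ × ℕ) ≃ ℕ × ℕ × ℕ where
  toFun q := (q.2.1, q.2.2, q.1)
  invFun i := (i.2.2, (i.1, i.2.1))
  left_inv _ := rfl
  right_inv _ := rfl

theorem seriesTermKernelA2_tripleIndexEquiv {a : ℝ} (ha : 0 < a) {z : ℂ}
    (h : z = 0 ∨ ∀ n : ℕ, 1 ≤ n → a ≠ n) (x y : ℂ) (k : ℕ) (q : ℕ × ℕ) :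
    seriesTermKernelA2 a x y z (tripleIndexEquiv (k, q)) = confluentCoeff a k * z ^ k *
      ((ascPochhammer ℂ (q.1 + q.2)).eval ((a : ℂ) - k) /
        ((q.1.factorial : ℂ) * (q.2.factorial : ℂ)) * (x ^ q.1 * y ^ q.2)) := by
  have := pochhammerInt_sub_mul_pow ha h (q.1 + q.2) k
  push_cast at this
  simp only [seriesTermKernelA2, tripleIndexEquiv, Equiv.coe_fn_mk]
  calc _ = (pochhammerInt a ((q.1 : ℤ) + q.2 - k) / (k.factorial : ℂ) * z ^ k) *
      (x ^ q.1 * y ^ q.2 / ((q.1.factorial : ℂ) * (q.2.factorial : ℂ))) := by ring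
    _ = _ := by rw [this]; ring

/-- For fixed `k`, the sum over `m` and `n` is at most that of the binomial series of exponent
`-(a + k)` at `‖x‖ + ‖y‖`, which is summable over `k` against the coefficients of `confluentFun`. -/
theorem summable_norm_seriesTermKernelA2 {a : ℝ} (ha : 0 < a) {z : ℂ}
    (h : z = 0 ∨ ∀ n : ℕ, 1 ≤ n → a ≠ n) {x y : ℂ} (hxy : ‖x‖ + ‖y‖ < 1) :
    Summable fun i => ‖seriesTermKernelA2 a x y z i‖ := by
  have hs : 0 < 1 - (‖x‖ + ‖y‖) := by linarith
  have hin : ∀ k : ℕ, HasSum (fun q : ℕ × ℕ => ‖confluentCoeff a k * z ^ k‖ *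
      ((ascPochhammer ℝ (q.1 + q.2)).eval (a + k) /
        ((q.1.factorial : ℝ) * (q.2.factorial : ℝ)) * (‖x‖ ^ q.1 * ‖y‖ ^ q.2)))
      (‖confluentCoeff a k * z ^ k‖ * (1 / (1 - (‖x‖ + ‖y‖)) ^ (a + k))) := fun k =>
    (hasSum_ascPochhammer_prod_of_nonneg (r := a + k) (by positivity) (norm_nonneg x)
      (norm_nonneg y) hxy).mul_left _
  have hasc : ∀ k j : ℕ, ‖(ascPochhammer ℂ j).eval ((a : ℂ) - k)‖ ≤
      (ascPochhammer ℝ j).eval (a + k) := fun k j => by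
    refine norm_eval_ascPochhammer_le _ ((norm_sub_le _ _).trans ?_) j
    simp [abs_of_pos ha]
  rw [← tripleIndexEquiv.summable_iff]
  refine Summable.of_nonneg_of_le (f := fun q : ℕ × (ℕ × ℕ) => ‖confluentCoeff a q.1 * z ^ q.1‖ *
      ((ascPochhammer ℝ (q.2.1 + q.2.2)).eval (a + q.1) /
        ((q.2.1.factorial : ℝ) * (q.2.2.factorial : ℝ)) * (‖x‖ ^ q.2.1 * ‖y‖ ^ q.2.2)))
      (fun _ => norm_nonneg _) (fun ⟨k, q⟩ => ?_) ?_
  · simp only [Function.comp_apply]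
    rw [seriesTermKernelA2_tripleIndexEquiv ha h, norm_mul]
    simp only [norm_mul (_ / _), norm_div, norm_mul (_ ^ _), norm_mul (Nat.cast _), norm_pow,
      Complex.norm_natCast]
    gcongr
    exact hasc _ _
  · rw [summable_prod_of_nonneg]
    · refine ⟨fun k => (hin k).summable, ?_⟩
      simp only [(hin _).tsum_eq]
      refine ((summable_norm_confluentCoeff_mul_pow a
        (z / ((1 - (‖x‖ + ‖y‖) : ℝ) : ℂ))).mul_left (1 / (1 - (‖x‖ + ‖y‖)) ^ a)).congr fun k => ?_
      rw [Real.rpow_add hs, Real.rpow_natCast]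
      simp only [norm_mul, norm_pow, norm_div, Complex.norm_real, Real.norm_of_nonneg hs.le,
        div_pow]
      have := hs.ne'
      field_simp
    · intro q
      have := (norm_nonneg _).trans (hasc q.1 (q.2.1 + q.2.2))
      simp only [Pi.zero_apply]
      positivity

theorem hasSum_seriesTermKernelA2 {a : ℝ} (ha : 0 < a) {z : ℂ}
    (h : z = 0 ∨ ∀ n : ℕ, 1 ≤ n → a ≠ n) {x y : ℂ} (hxy : ‖x‖ + ‖y‖ < 1) :
    HasSum (seriesTermKernelA2 a x y z) (kernelA2 a z (1 - (x + y))) := by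
  have hsum := (summable_norm_seriesTermKernelA2 ha h hxy).of_norm.hasSum
  have hw : 1 - (x + y) ≠ 0 := by
    intro h0
    have : ‖x + y‖ = 1 := by
      rw [← sub_eq_zero.1 h0]
      simp
    linarith [norm_add_le x y]
  have h1 := (tripleIndexEquiv.hasSum_iff.2 hsum).prod_fiberwise fun k => by
    simp only [Function.comp_apply, seriesTermKernelA2_tripleIndexEquiv ha h]
    exact (Complex.hasSum_ascPochhammer_prod ((a : ℂ) - k) hxy).mul_left _
  have h2 := (hasSum_confluentFun a (z * (1 - (x + y)))).mul_left ((1 - (x + y)) ^ (-(a : ℂ)))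
  have h3 : (fun k : ℕ => confluentCoeff a k * z ^ k * (1 / (1 - (x + y)) ^ ((a : ℂ) - k))) =
      fun k : ℕ => (1 - (x + y)) ^ (-(a : ℂ)) *
        (confluentCoeff a k * (z * (1 - (x + y))) ^ k) := by
    funext k
    rw [one_div, ← Complex.cpow_neg, neg_sub, show (k : ℂ) - a = -a + k by ring,
      Complex.cpow_add _ _ hw, Complex.cpow_natCast, mul_pow]
    ring
  rw [h3] at h1
  rw [kernelA2, h2.unique h1]
  exact hsum

/-! ### The beta distribution -/

theorem ae_betaMeasure_mem_Ioo (s t : ℝ) : ∀ᵐ u ∂betaMeasure s t, u ∈ Ioo (0 : ℝ) 1 := by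
  rw [betaMeasure, ae_withDensity_iff (by unfold betaPDF; fun_prop)]
  refine Eventually.of_forall fun u hu => ?_
  by_contra h
  apply hu
  simp only [betaPDF_eq]
  rw [if_neg (show ¬(0 < u ∧ u < 1) from h), ENNReal.ofReal_zero]

theorem integral_betaMeasure {s t : ℝ} (hs : 0 < s) (ht : 0 < t) (f : ℝ → ℝ) :
    ∫ u, f u ∂betaMeasure s t =
      (1 / beta s t) * ∫ u in Ioo (0 : ℝ) 1, u ^ (s - 1) * (1 - u) ^ (t - 1) * f u := by
  rw [betaMeasure, integral_withDensity_eq_integral_toReal_smul (by unfold betaPDF; fun_prop)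
    (by simp [betaPDF]), ← integral_const_mul, ← integral_indicator measurableSet_Ioo]
  congr 1 with u
  by_cases hu : u ∈ Ioo (0 : ℝ) 1
  · rw [indicator_of_mem hu, betaPDF, ENNReal.toReal_ofReal (betaPDFReal_pos hu.1 hu.2 hs ht).le,
      betaPDFReal, if_pos (show 0 < u ∧ u < 1 from hu), smul_eq_mul]
    ring
  · rw [indicator_of_notMem hu, betaPDF, betaPDFReal, if_neg (show ¬(0 < u ∧ u < 1) from hu)]
    simp

theorem integral_pow_betaMeasure {s t : ℝ} (hs : 0 < s) (ht : 0 < t) (m : ℕ) :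
    ∫ u, u ^ m ∂betaMeasure s t = beta (s + m) t / beta s t := by
  have hsm : 0 < s + m := by positivity
  have := isProbabilityMeasureBeta hsm ht
  have h1 : ∫ _, (1 : ℝ) ∂betaMeasure (s + m) t = 1 := by simp
  rw [integral_betaMeasure hsm ht] at h1
  rw [integral_betaMeasure hs ht]
  have hB := beta_pos hsm ht
  have hB' := beta_pos hs ht
  have h2 : ∫ u in Ioo (0 : ℝ) 1, u ^ (s - 1) * (1 - u) ^ (t - 1) * u ^ m =
      ∫ u in Ioo (0 : ℝ) 1, u ^ (s + m - 1) * (1 - u) ^ (t - 1) * 1 := by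
    refine setIntegral_congr_fun measurableSet_Ioo fun u hu => ?_
    rw [show s + m - 1 = (s - 1) + m by ring, Real.rpow_add hu.1, Real.rpow_natCast]
    ring
  -- the density of parameters `(s + m, t)` has total mass `1`
  rw [h2]
  rw [one_div, inv_mul_eq_one₀ hB.ne'] at h1
  rw [← h1]
  ring

theorem integral_ofReal_pow_betaMeasure {s t : ℝ} (hs : 0 < s) (ht : 0 < t) (m : ℕ) :
    ∫ u, (u : ℂ) ^ m ∂betaMeasure s t =
      pochhammerInt s m / pochhammerInt ((s + t : ℝ) : ℂ) m := by
  have h := integral_pow_betaMeasure hs ht m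
  simp only [← Complex.ofReal_pow]
  rw [integral_complex_ofReal, h]
  have e1 : pochhammerInt s m = ((Real.Gamma (s + m) / Real.Gamma s : ℝ) : ℂ) := by
    simp only [pochhammerInt, Int.cast_natCast]
    push_cast [← Complex.Gamma_ofReal]
    rfl
  have e2 : pochhammerInt ((s + t : ℝ) : ℂ) m =
      ((Real.Gamma (s + t + m) / Real.Gamma (s + t) : ℝ) : ℂ) := by
    simp only [pochhammerInt, Int.cast_natCast]
    push_cast [← Complex.Gamma_ofReal]
    rfl
  rw [e1, e2, ← Complex.ofReal_div]
  have h1 := (Real.Gamma_pos_of_pos hs).ne'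
  have h2 := (Real.Gamma_pos_of_pos ht).ne'
  have h3 := (Real.Gamma_pos_of_pos (add_pos hs ht)).ne'
  have h4 := (Real.Gamma_pos_of_pos (show 0 < s + t + m by positivity)).ne'
  have h5 : s + m + t = s + t + m := by ring
  norm_cast
  rw [beta, beta, h5]
  field_simp

/-! ### The integral representation gives the continuation -/

theorem isOpen_domainA2 : IsOpen domainA2 :=
  (isOpen_lt (Complex.continuous_re.comp continuous_fst) continuous_const).inter
    (isOpen_lt (Complex.continuous_re.comp continuous_snd) continuous_const)

theorem re_one_sub_pos_of_mem_domainA2 {w : ℂ × ℂ} (hw : w ∈ domainA2) {q : ℝ × ℝ}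
    (hq : q ∈ Icc (0 : ℝ) 1 ×ˢ Icc (0 : ℝ) 1) : 0 < (1 - (w.1 * q.1 + w.2 * q.2)).re := by
  obtain ⟨⟨h1, h2⟩, h3, h4⟩ := hq
  have key : ∀ r t : ℝ, r < 1 / 2 → 0 ≤ t → t ≤ 1 → r * t < 1 / 2 := by
    intro r t hr h0 ht
    rcases h0.eq_or_lt with rfl | h0
    · norm_num
    · nlinarith
  have k1 := key _ _ hw.1 h1 h2
  have k2 := key _ _ hw.2 h3 h4
  simp only [Complex.sub_re, Complex.one_re, Complex.add_re, Complex.mul_re, Complex.ofReal_re,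
    Complex.ofReal_im, mul_zero, sub_zero]
  linarith

/-- Averages over `[0, 1]²` of a holomorphic function of `1 - x u - y v` are holomorphic, as the
derivatives are bounded on a compact neighbourhood times the square. -/
theorem differentiableOn_integral_one_sub {μ : Measure (ℝ × ℝ)} [IsFiniteMeasure μ]
    (hμ : ∀ᵐ q ∂μ, q ∈ Icc (0 : ℝ) 1 ×ˢ Icc (0 : ℝ) 1) {g : ℂ → ℂ}
    (hg : DifferentiableOn ℂ g {w | 0 < w.re}) :
    DifferentiableOn ℂ (fun w : ℂ × ℂ => ∫ q, g (1 - (w.1 * (q.1 : ℝ) + w.2 * (q.2 : ℝ))) ∂μ)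
      domainA2 := by
  intro w₀ hw₀
  have hU : IsOpen {w : ℂ | 0 < w.re} := isOpen_lt continuous_const Complex.continuous_re
  have hS : IsCompact (Icc (0 : ℝ) 1 ×ˢ Icc (0 : ℝ) 1) := isCompact_Icc.prod isCompact_Icc
  have hμS : μ.restrict (Icc (0 : ℝ) 1 ×ˢ Icc (0 : ℝ) 1) = μ :=
    Measure.restrict_eq_self_of_ae_mem hμ
  obtain ⟨ε, hε, hball⟩ := Metric.nhds_basis_closedBall.mem_iff.1 (isOpen_domainA2.mem_nhds hw₀)
  have hl : Continuous fun p : (ℂ × ℂ) × (ℝ × ℝ) =>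
    1 - (p.1.1 * (p.2.1 : ℂ) + p.1.2 * (p.2.2 : ℂ)) := by fun_prop
  have hdg : DifferentiableOn ℂ (deriv g) {w | 0 < w.re} := hg.deriv hU
  obtain ⟨C, hC⟩ := ((isCompact_closedBall w₀ ε).prod hS).exists_bound_of_continuousOn
    (f := fun p => deriv g (1 - (p.1.1 * (p.2.1 : ℂ) + p.1.2 * (p.2.2 : ℂ))))
    (hdg.continuousOn.comp hl.continuousOn
      fun p hp => re_one_sub_pos_of_mem_domainA2 (hball hp.1) hp.2)
  have hmeas : ∀ w ∈ domainA2, ∀ f : ℂ → ℂ, DifferentiableOn ℂ f {w | 0 < w.re} →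
      ContinuousOn (fun q : ℝ × ℝ => f (1 - (w.1 * (q.1 : ℂ) + w.2 * (q.2 : ℂ))))
        (Icc (0 : ℝ) 1 ×ˢ Icc (0 : ℝ) 1) := fun w hw f hf =>
    hf.continuousOn.comp (by fun_prop) fun q hq => re_one_sub_pos_of_mem_domainA2 hw hq
  let A : ℝ × ℝ → (ℂ × ℂ →L[ℂ] ℂ) := fun q =>
    -((q.1 : ℂ) • ContinuousLinearMap.fst ℂ ℂ ℂ + (q.2 : ℂ) • ContinuousLinearMap.snd ℂ ℂ ℂ)
  have hA : Continuous A := by fun_prop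
  have hAbound : ∀ q ∈ Icc (0 : ℝ) 1 ×ˢ Icc (0 : ℝ) 1, ‖A q‖ ≤ 2 := by
    intro q hq
    refine ContinuousLinearMap.opNorm_le_bound _ (by norm_num) fun v => ?_
    have h1 : ‖(q.1 : ℂ)‖ ≤ 1 := by
      rw [Complex.norm_real, Real.norm_of_nonneg hq.1.1]
      exact hq.1.2
    have h2 : ‖(q.2 : ℂ)‖ ≤ 1 := by
      rw [Complex.norm_real, Real.norm_of_nonneg hq.2.1]
      exact hq.2.2
    calc ‖A q v‖ = ‖(q.1 : ℂ) * v.1 + (q.2 : ℂ) * v.2‖ := by simp [A, -neg_add_rev]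
      _ ≤ ‖(q.1 : ℂ)‖ * ‖v.1‖ + ‖(q.2 : ℂ)‖ * ‖v.2‖ := by
        rw [← norm_mul, ← norm_mul]
        exact norm_add_le _ _
      _ ≤ 1 * ‖v‖ + 1 * ‖v‖ := by
        have h3 : ‖v.1‖ ≤ ‖v‖ := norm_fst_le v
        have h4 : ‖v.2‖ ≤ ‖v‖ := norm_snd_le v
        gcongr
      _ = 2 * ‖v‖ := by ring
  have h := hasFDerivAt_integral_of_dominated_of_fderiv_le (μ := μ) (𝕜 := ℂ) (x₀ := w₀)
    (s := Metric.closedBall w₀ ε) (bound := fun _ => |C| * 2)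
    (F := fun w q => g (1 - (w.1 * (q.1 : ℂ) + w.2 * (q.2 : ℂ))))
    (F' := fun w q => deriv g (1 - (w.1 * (q.1 : ℂ) + w.2 * (q.2 : ℂ))) • A q)
    (Metric.closedBall_mem_nhds _ hε) ?_ ?_ ?_ ?_ (integrable_const _) ?_
  · exact h.differentiableAt.differentiableWithinAt
  · filter_upwards [isOpen_domainA2.mem_nhds hw₀] with w hw
    rw [← hμS]
    exact (hmeas w hw g hg).aestronglyMeasurable hS.measurableSet
  · rw [← hμS]
    exact (hmeas w₀ hw₀ g hg).integrableOn_compact hS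
  · rw [← hμS]
    exact ((hmeas w₀ hw₀ _ hdg).smul hA.continuousOn).aestronglyMeasurable hS.measurableSet
  · filter_upwards [hμ] with q hq w hw
    rw [norm_smul]
    gcongr
    · exact (hC (w, q) ⟨hw, hq⟩).trans (le_abs_self C)
    · exact hAbound q hq
  · filter_upwards [hμ] with q hq w hw
    have hpos := re_one_sub_pos_of_mem_domainA2 (hball hw) hq
    have h1 : HasDerivAt g _ (1 - (w.1 * (q.1 : ℂ) + w.2 * (q.2 : ℂ))) :=
      ((hg _ hpos).differentiableAt (hU.mem_nhds hpos)).hasDerivAt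
    refine h1.comp_hasFDerivAt w (f := fun w : ℂ × ℂ => 1 - (w.1 * (q.1 : ℂ) + w.2 * (q.2 : ℂ))) ?_
    exact ((hasFDerivAt_fst.mul_const _).add (hasFDerivAt_snd.mul_const _)).const_sub 1

/-- The law of a pair of independent variables, with symmetric beta distributions of parameters
`b₁` and `b₂`. -/
def betaProd (b₁ b₂ : ℝ) : Measure (ℝ × ℝ) := (betaMeasure b₁ b₁).prod (betaMeasure b₂ b₂)

theorem isProbabilityMeasure_betaProd {b₁ b₂ : ℝ} (h₁ : 0 < b₁) (h₂ : 0 < b₂) :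
    IsProbabilityMeasure (betaProd b₁ b₂) := by
  have := isProbabilityMeasureBeta h₁ h₁
  have := isProbabilityMeasureBeta h₂ h₂
  unfold betaProd
  infer_instance

theorem ae_betaProd_mem {b₁ b₂ : ℝ} (h₁ : 0 < b₁) (h₂ : 0 < b₂) :
    ∀ᵐ q ∂betaProd b₁ b₂, q ∈ Icc (0 : ℝ) 1 ×ˢ Icc (0 : ℝ) 1 := by
  have := isProbabilityMeasureBeta h₁ h₁
  have := isProbabilityMeasureBeta h₂ h₂
  filter_upwards [Measure.quasiMeasurePreserving_fst.ae (ae_betaMeasure_mem_Ioo b₁ b₁),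
    Measure.quasiMeasurePreserving_snd.ae (ae_betaMeasure_mem_Ioo b₂ b₂)] with q hq1 hq2
  exact ⟨Ioo_subset_Icc_self hq1, Ioo_subset_Icc_self hq2⟩

/-- The function `A₂` with `c₁ = 2 b₁` and `c₂ = 2 b₂`, as the average of its kernel over beta
distributions. -/
def integralA2 (a b₁ b₂ : ℝ) (z : ℂ) (w : ℂ × ℂ) : ℂ :=
  ∫ q, kernelA2 a z (1 - (w.1 * (q.1 : ℝ) + w.2 * (q.2 : ℝ))) ∂betaProd b₁ b₂

/-- Termwise integration of the triple series of the kernel: the moments of the beta distributions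
supply the factors `(b₁)_m / (2 b₁)_m` and `(b₂)_n / (2 b₂)_n`. -/
theorem isContinuationA2_integralA2 {a b₁ b₂ : ℝ} (ha : 0 < a) (h₁ : 0 < b₁) (h₂ : 0 < b₂) {z : ℂ}
    (hz : z = 0 ∨ ∀ n : ℕ, 1 ≤ n → a ≠ n) :
    IsContinuationA2 a b₁ b₂ ((2 * b₁ : ℝ) : ℂ) ((2 * b₂ : ℝ) : ℂ) z (integralA2 a b₁ b₂ z) where
  holomorphic := by
    have := isProbabilityMeasure_betaProd h₁ h₂
    exact differentiableOn_integral_one_sub (ae_betaProd_mem h₁ h₂) (differentiableOn_kernelA2 a z)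
  hasSum := by
    rintro ⟨x, y⟩ hw hxy
    have := isProbabilityMeasure_betaProd h₁ h₂
    have := isProbabilityMeasureBeta h₁ h₁
    have := isProbabilityMeasureBeta h₂ h₂
    have hae := ae_betaProd_mem h₁ h₂
    have hF : ∀ i : ℕ × ℕ × ℕ, ∀ q : ℝ × ℝ, seriesTermKernelA2 a (x * q.1) (y * q.2) z i =
        seriesTermKernelA2 a x y z i * ((q.1 : ℂ) ^ i.1 * (q.2 : ℂ) ^ i.2.1) := by
      intro i q
      simp only [seriesTermKernelA2]
      ring
    have hle : ∀ i : ℕ × ℕ × ℕ, ∀ᵐ q ∂betaProd b₁ b₂,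
        ‖seriesTermKernelA2 a (x * q.1) (y * q.2) z i‖ ≤ ‖seriesTermKernelA2 a x y z i‖ := by
      intro i
      filter_upwards [hae] with q hq
      rw [hF, norm_mul]
      refine mul_le_of_le_one_right (norm_nonneg _) ?_
      rw [norm_mul, norm_pow, norm_pow, Complex.norm_real, Complex.norm_real,
        Real.norm_of_nonneg hq.1.1, Real.norm_of_nonneg hq.2.1]
      exact mul_le_one₀ (pow_le_one₀ hq.1.1 hq.1.2) (pow_nonneg hq.2.1 _)
        (pow_le_one₀ hq.2.1 hq.2.2)
    have hint : ∀ i : ℕ × ℕ × ℕ, Integrable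
        (fun q : ℝ × ℝ => seriesTermKernelA2 a (x * q.1) (y * q.2) z i) (betaProd b₁ b₂) := by
      intro i
      refine Integrable.of_bound ?_ _ (hle i)
      simp only [hF]
      exact Continuous.aestronglyMeasurable (by fun_prop)
    have hsum : Summable fun i : ℕ × ℕ × ℕ =>
        ∫ q, ‖seriesTermKernelA2 a (x * q.1) (y * q.2) z i‖ ∂betaProd b₁ b₂ := by
      refine Summable.of_nonneg_of_le (fun i => integral_nonneg fun q => norm_nonneg _)
        (fun i => ?_) (summable_norm_seriesTermKernelA2 ha hz hxy)
      exact (integral_mono_ae (hint i).norm (integrable_const _) (hle i)).trans (by simp)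
    have h := hasSum_integral_of_summable_integral_norm hint hsum
    have e1 : ∀ i : ℕ × ℕ × ℕ,
        ∫ q, seriesTermKernelA2 a (x * q.1) (y * q.2) z i ∂betaProd b₁ b₂ =
          seriesTermA2 a b₁ b₂ ((2 * b₁ : ℝ) : ℂ) ((2 * b₂ : ℝ) : ℂ) x y z i := by
      intro i
      simp only [hF]
      rw [integral_const_mul, betaProd, integral_prod_mul (fun u : ℝ => (u : ℂ) ^ i.1)
        (fun u : ℝ => (u : ℂ) ^ i.2.1), integral_ofReal_pow_betaMeasure h₁ h₁,
        integral_ofReal_pow_betaMeasure h₂ h₂, ← two_mul, ← two_mul]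
      simp only [seriesTermKernelA2, seriesTermA2]
      ring
    have e2 : ∫ q, ∑' i, seriesTermKernelA2 a (x * (q.1 : ℝ)) (y * (q.2 : ℝ)) z i ∂betaProd b₁ b₂ =
        integralA2 a b₁ b₂ z (x, y) := by
      refine integral_congr_ae ?_
      filter_upwards [hae] with q hq
      refine (hasSum_seriesTermKernelA2 ha hz ?_).tsum_eq
      refine lt_of_le_of_lt ?_ hxy
      rw [norm_mul, norm_mul, Complex.norm_real, Complex.norm_real,
        Real.norm_of_nonneg hq.1.1, Real.norm_of_nonneg hq.2.1]
      exact add_le_add (mul_le_of_le_one_right (norm_nonneg _) hq.1.2)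
        (mul_le_of_le_one_right (norm_nonneg _) hq.2.2)
    rw [← e2]
    exact h.congr_fun fun i => (e1 i).symm

/-! ### Asymptotics of the Laplace transform of the beta distribution -/

/-- The Laplace transform of the symmetric beta distribution of parameter `b`. -/
def laplaceBeta (b x : ℝ) : ℝ := ∫ u, Real.exp (-(x * u)) ∂betaMeasure b b

theorem rpow_mul_exp_neg_le_one {b t : ℝ} (hb₀ : 0 < b) (hb₁ : b < 1) (ht : 0 ≤ t) :
    t ^ b * Real.exp (-t) ≤ 1 := by
  rw [Real.exp_neg, ← div_eq_mul_inv, div_le_one (Real.exp_pos t)]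
  rcases le_total t 1 with h | h
  · exact (Real.rpow_le_one ht h hb₀.le).trans (Real.one_le_exp ht)
  · calc t ^ b ≤ t ^ (1 : ℝ) := Real.rpow_le_rpow_of_exponent_le h hb₁.le
      _ = t := Real.rpow_one t
      _ ≤ Real.exp t := by linarith [Real.add_one_le_exp t]

theorem integrableOn_one_sub_rpow {b : ℝ} (hb₀ : 0 < b) :
    IntegrableOn (fun u : ℝ => (1 - u) ^ (b - 1)) (Ioo 0 1) := by
  have h := (intervalIntegral.intervalIntegrable_rpow' (a := 1) (b := 0) (r := b - 1)
    (by linarith)).comp_sub_left 1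
  simp only [sub_self, sub_zero] at h
  rw [intervalIntegrable_iff_integrableOn_Ioo_of_le zero_le_one] at h
  exact h

/-- The quotient `((1 - u)^(b-1) - 1) / u` measures how far the beta density is from the gamma
density; it is integrable up to the end point `1`. -/
theorem abs_one_sub_rpow_sub_one_div_le {b u : ℝ} (hb₀ : 0 < b) (hb₁ : b < 1)
    (hu : u ∈ Ioo (0 : ℝ) 1) : |((1 - u) ^ (b - 1) - 1) / u| ≤ (1 - u) ^ (b - 1) := by
  have h1 : 0 < 1 - u := by linarith [hu.2]
  have h2 : 1 ≤ (1 - u) ^ (b - 1) :=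
    Real.one_le_rpow_of_pos_of_le_one_of_nonpos h1 (by linarith [hu.1]) (by linarith)
  have h3 : (1 - u) ^ (b - 1) * (1 - u) ≤ 1 := by
    rw [← Real.rpow_add_one h1.ne', sub_add_cancel]
    exact Real.rpow_le_one h1.le (by linarith [hu.1]) hb₀.le
  rw [abs_of_nonneg (div_nonneg (by linarith) hu.1.le), div_le_iff₀ hu.1]
  linarith

theorem integrableOn_laplaceBeta_remainder {b x : ℝ} (hb₀ : 0 < b) (hb₁ : b < 1) (hx : 0 < x) :
    IntegrableOn (fun u : ℝ => (x * u) ^ b * Real.exp (-(x * u)) *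
      (((1 - u) ^ (b - 1) - 1) / u)) (Ioo 0 1) := by
  refine Integrable.mono' (integrableOn_one_sub_rpow hb₀)
    (Measurable.aestronglyMeasurable (by fun_prop)) ?_
  refine ae_restrict_of_forall_mem measurableSet_Ioo fun u hu => ?_
  have hxu : 0 ≤ x * u := mul_nonneg hx.le hu.1.le
  rw [Real.norm_eq_abs, abs_mul, abs_of_nonneg (by positivity)]
  exact (mul_le_of_le_one_left (abs_nonneg _) (rpow_mul_exp_neg_le_one hb₀ hb₁ hxu)).trans
    (abs_one_sub_rpow_sub_one_div_le hb₀ hb₁ hu)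

/-- Scaling out `x`: the Laplace transform is an incomplete gamma integral plus a remainder. -/
theorem rpow_mul_laplaceBeta_eq {b x : ℝ} (hb₀ : 0 < b) (hb₁ : b < 1) (hx : 0 < x) :
    x ^ b * laplaceBeta b x = 1 / beta b b * ((∫ s in (0 : ℝ)..x, Real.exp (-s) * s ^ (b - 1)) +
      ∫ u in Ioo (0 : ℝ) 1, (x * u) ^ b * Real.exp (-(x * u)) *
        (((1 - u) ^ (b - 1) - 1) / u)) := by
  have e1 : ∫ s in (0 : ℝ)..x, Real.exp (-s) * s ^ (b - 1) =
      ∫ u in Ioo (0 : ℝ) 1, x * (Real.exp (-(x * u)) * (x * u) ^ (b - 1)) := by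
    have := intervalIntegral.mul_integral_comp_mul_left (a := 0) (b := 1) x
      (f := fun s => Real.exp (-s) * s ^ (b - 1))
    rw [mul_zero, mul_one] at this
    rw [← this, intervalIntegral.integral_of_le zero_le_one, integral_Ioc_eq_integral_Ioo,
      integral_const_mul]
  have hi : IntegrableOn (fun u : ℝ => x * (Real.exp (-(x * u)) * (x * u) ^ (b - 1)))
      (Ioo 0 1) := by
    have h0 : IntegrableOn (fun u : ℝ => u ^ (b - 1)) (Ioo 0 1) := by
      rw [← intervalIntegrable_iff_integrableOn_Ioo_of_le zero_le_one]
      exact intervalIntegral.intervalIntegrable_rpow' (by linarith)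
    refine Integrable.mono' (h0.const_mul (x * x ^ (b - 1)))
      (Measurable.aestronglyMeasurable (by fun_prop)) ?_
    refine ae_restrict_of_forall_mem measurableSet_Ioo fun u hu => ?_
    have hu0 := hu.1
    rw [Real.mul_rpow hx.le hu0.le, Real.norm_of_nonneg (by positivity)]
    have : Real.exp (-(x * u)) ≤ 1 := Real.exp_le_one_iff.2 (by nlinarith)
    calc _ = Real.exp (-(x * u)) * (x * x ^ (b - 1) * u ^ (b - 1)) := by ring
      _ ≤ _ := mul_le_of_le_one_left (by positivity) this
  rw [e1, ← integral_add hi (integrableOn_laplaceBeta_remainder hb₀ hb₁ hx), laplaceBeta,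
    integral_betaMeasure hb₀ hb₀, mul_left_comm, ← integral_const_mul]
  congr 1
  refine setIntegral_congr_fun measurableSet_Ioo fun u hu => ?_
  have hu0 := hu.1
  rw [Real.mul_rpow hx.le hu0.le, Real.mul_rpow hx.le hu0.le, Real.rpow_sub_one hx.ne',
    Real.rpow_sub_one hu0.ne']
  field_simp
  ring

theorem tendsto_rpow_mul_laplaceBeta {b : ℝ} (hb₀ : 0 < b) (hb₁ : b < 1) :
    Tendsto (fun x => x ^ b * laplaceBeta b x) atTop (𝓝 (Real.Gamma b / beta b b)) := by
  have h1 : Tendsto (fun x : ℝ => ∫ s in (0 : ℝ)..x, Real.exp (-s) * s ^ (b - 1)) atTop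
      (𝓝 (Real.Gamma b)) := by
    rw [Real.Gamma_eq_integral hb₀]
    exact intervalIntegral_tendsto_integral_Ioi 0 (Real.GammaIntegral_convergent hb₀) tendsto_id
  have h2 : Tendsto (fun x : ℝ => ∫ u in Ioo (0 : ℝ) 1, (x * u) ^ b * Real.exp (-(x * u)) *
      (((1 - u) ^ (b - 1) - 1) / u)) atTop (𝓝 (∫ u in Ioo (0 : ℝ) 1, (0 : ℝ))) := by
    refine tendsto_integral_filter_of_dominated_convergence (fun u => (1 - u) ^ (b - 1)) ?_ ?_
      (integrableOn_one_sub_rpow hb₀) ?_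
    · exact Eventually.of_forall fun x => Measurable.aestronglyMeasurable (by fun_prop)
    · filter_upwards [eventually_gt_atTop 0] with x hx
      refine ae_restrict_of_forall_mem measurableSet_Ioo fun u hu => ?_
      have hxu : 0 ≤ x * u := mul_nonneg hx.le hu.1.le
      rw [Real.norm_eq_abs, abs_mul, abs_of_nonneg (by positivity)]
      exact (mul_le_of_le_one_left (abs_nonneg _) (rpow_mul_exp_neg_le_one hb₀ hb₁ hxu)).trans
        (abs_one_sub_rpow_sub_one_div_le hb₀ hb₁ hu)
    · refine ae_restrict_of_forall_mem measurableSet_Ioo fun u hu => ?_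
      have h := (tendsto_rpow_mul_exp_neg_mul_atTop_nhds_zero b 1 one_pos).comp
        (tendsto_id.atTop_mul_const hu.1)
      have h' := h.mul_const (((1 - u) ^ (b - 1) - 1) / u)
      simpa using h'
  have h3 := (h1.add h2).const_mul (1 / beta b b)
  simp only [integral_zero, add_zero, one_div_mul_eq_div] at h3
  refine h3.congr' ?_
  filter_upwards [eventually_gt_atTop 0] with x hx
  rw [rpow_mul_laplaceBeta_eq hb₀ hb₁ hx, one_div_mul_eq_div]

theorem laplaceBeta_nonneg (b x : ℝ) : 0 ≤ laplaceBeta b x :=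
  integral_nonneg fun _ => (Real.exp_pos _).le

theorem exists_rpow_mul_laplaceBeta_le {b : ℝ} (hb₀ : 0 < b) (hb₁ : b < 1) :
    ∃ C, ∀ x, 0 < x → x ^ b * laplaceBeta b x ≤ C := by
  refine ⟨1 / beta b b * (Real.Gamma b + ∫ u in Ioo (0 : ℝ) 1, (1 - u) ^ (b - 1)),
    fun x hx => ?_⟩
  rw [rpow_mul_laplaceBeta_eq hb₀ hb₁ hx]
  have := beta_pos hb₀ hb₀
  refine mul_le_mul_of_nonneg_left (add_le_add ?_ ?_) (by positivity)
  · rw [Real.Gamma_eq_integral hb₀, intervalIntegral.integral_of_le hx.le]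
    refine setIntegral_mono_set (Real.GammaIntegral_convergent hb₀) ?_
      (Eventually.of_forall Ioc_subset_Ioi_self)
    refine ae_restrict_of_forall_mem measurableSet_Ioi fun u hu => ?_
    have : (0 : ℝ) < u := hu
    simp only [Pi.zero_apply]
    positivity
  · refine setIntegral_mono_on (integrableOn_laplaceBeta_remainder hb₀ hb₁ hx)
      (integrableOn_one_sub_rpow hb₀) measurableSet_Ioo fun u hu => ?_
    have hxu : 0 ≤ x * u := mul_nonneg hx.le hu.1.le
    refine (le_abs_self _).trans ?_
    rw [abs_mul, abs_of_nonneg (by positivity)]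
    exact (mul_le_of_le_one_left (abs_nonneg _) (rpow_mul_exp_neg_le_one hb₀ hb₁ hxu)).trans
      (abs_one_sub_rpow_sub_one_div_le hb₀ hb₁ hu)

theorem measurable_laplaceBeta {b : ℝ} (hb : 0 < b) : Measurable (laplaceBeta b) := by
  have := isProbabilityMeasureBeta hb hb
  have h : StronglyMeasurable fun q : ℝ × ℝ => Real.exp (-(q.1 * q.2)) :=
    Continuous.stronglyMeasurable (by fun_prop)
  exact (h.integral_prod_right' (ν := betaMeasure b b)).measurable

/-! ### Asymptotics of the average of a power -/

/-- The average of `(1 + X u + Y v) ^ (-a)` over beta distributions of parameters `b₁`, `b₂`. -/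
def powerAverage (a b₁ b₂ X Y : ℝ) : ℝ :=
  ∫ q, (1 + X * (q.1 : ℝ) + Y * (q.2 : ℝ)) ^ (-a) ∂betaProd b₁ b₂

/-- The power is written as a gamma integral, `w ^ (-a) = 1 / Γ(a) ∫ t ^ (a - 1) e ^ (-w t) dt`;
the exponential then factors over the independent variables. -/
theorem powerAverage_eq_integral_laplaceBeta {a b₁ b₂ X Y : ℝ} (ha : 0 < a) (h₁ : 0 < b₁)
    (h₂ : 0 < b₂) (hX : 0 ≤ X) (hY : 0 ≤ Y) :
    powerAverage a b₁ b₂ X Y = 1 / Real.Gamma a * ∫ t in Ioi (0 : ℝ),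
      t ^ (a - 1) * Real.exp (-t) * (laplaceBeta b₁ (X * t) * laplaceBeta b₂ (Y * t)) := by
  have := isProbabilityMeasure_betaProd h₁ h₂
  have := isProbabilityMeasureBeta h₁ h₁
  have := isProbabilityMeasureBeta h₂ h₂
  have hG := Real.Gamma_pos_of_pos ha
  have hae := ae_betaProd_mem h₁ h₂
  have e1 : ∀ᵐ q ∂betaProd b₁ b₂, (1 + X * q.1 + Y * q.2) ^ (-a) = 1 / Real.Gamma a *
      ∫ t in Ioi (0 : ℝ), t ^ (a - 1) * Real.exp (-((1 + X * q.1 + Y * q.2) * t)) := by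
    filter_upwards [hae] with q hq
    have hpos : 0 < 1 + X * q.1 + Y * q.2 := by
      have := mul_nonneg hX hq.1.1
      have := mul_nonneg hY hq.2.1
      linarith
    rw [Real.integral_rpow_mul_exp_neg_mul_Ioi ha hpos, one_div, one_div,
      Real.inv_rpow hpos.le, Real.rpow_neg hpos.le]
    field_simp
  rw [powerAverage, integral_congr_ae e1, integral_const_mul, integral_integral_swap]
  · congr 1
    refine setIntegral_congr_fun measurableSet_Ioi fun t ht => ?_
    simp only [betaProd, laplaceBeta]
    rw [← integral_prod_mul (fun u : ℝ => Real.exp (-(X * t * u)))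
      (fun u : ℝ => Real.exp (-(Y * t * u))), ← integral_const_mul]
    congr 1 with q
    rw [mul_assoc, ← Real.exp_add, ← Real.exp_add]
    ring_nf
  · have hg : Integrable (fun t : ℝ => Real.exp (-t) * t ^ (a - 1)) (volume.restrict (Ioi 0)) :=
      Real.GammaIntegral_convergent ha
    refine Integrable.mono' (hg.comp_snd (betaProd b₁ b₂))
      (Measurable.aestronglyMeasurable (by fun_prop)) ?_
    have hq' := Measure.quasiMeasurePreserving_fst (μ := betaProd b₁ b₂)
      (ν := (volume : Measure ℝ).restrict (Ioi 0)) |>.ae hae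
    have ht' := Measure.quasiMeasurePreserving_snd (μ := betaProd b₁ b₂)
      (ν := (volume : Measure ℝ).restrict (Ioi 0)) |>.ae (ae_restrict_mem measurableSet_Ioi)
    filter_upwards [hq', ht'] with r hr ht
    have ht0 : 0 < r.2 := ht
    simp only [Function.uncurry]
    rw [Real.norm_of_nonneg (by positivity), mul_comm]
    gcongr
    have h3 := mul_nonneg hX hr.1.1
    have h4 := mul_nonneg hY hr.2.1
    nlinarith

/-- If `a > b₁ + b₂`, then `powerAverage a b₁ b₂ X Y` is of the exact order `X ^ (-b₁) Y ^ (-b₂)`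
for large `X` and `Y`. -/
theorem tendsto_rpow_mul_powerAverage {a b₁ b₂ : ℝ} (h₁ : 0 < b₁) (h₁' : b₁ < 1) (h₂ : 0 < b₂)
    (h₂' : b₂ < 1) (ha : b₁ + b₂ < a) :
    Tendsto (fun Q : ℝ × ℝ => Q.1 ^ b₁ * Q.2 ^ b₂ * powerAverage a b₁ b₂ Q.1 Q.2)
      (atTop ×ˢ atTop) (𝓝 (1 / Real.Gamma a * (Real.Gamma (a - b₁ - b₂) *
        (Real.Gamma b₁ / beta b₁ b₁ * (Real.Gamma b₂ / beta b₂ b₂))))) := by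
  have hab : 0 < a - b₁ - b₂ := by linarith
  obtain ⟨C₁, hC₁⟩ := exists_rpow_mul_laplaceBeta_le h₁ h₁'
  obtain ⟨C₂, hC₂⟩ := exists_rpow_mul_laplaceBeta_le h₂ h₂'
  have hN₁ : ∀ x, 0 < x → 0 ≤ x ^ b₁ * laplaceBeta b₁ x := fun x hx =>
    mul_nonneg (Real.rpow_nonneg hx.le _) (laplaceBeta_nonneg _ _)
  have hN₂ : ∀ x, 0 < x → 0 ≤ x ^ b₂ * laplaceBeta b₂ x := fun x hx =>
    mul_nonneg (Real.rpow_nonneg hx.le _) (laplaceBeta_nonneg _ _)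
  have hm₁ := measurable_laplaceBeta h₁
  have hm₂ := measurable_laplaceBeta h₂
  have hpos : ∀ᶠ Q : ℝ × ℝ in atTop ×ˢ atTop, 0 < Q.1 ∧ 0 < Q.2 :=
    (eventually_gt_atTop 0).prod_mk (eventually_gt_atTop 0)
  have hlim : Tendsto (fun Q : ℝ × ℝ => ∫ t in Ioi (0 : ℝ),
      Real.exp (-t) * t ^ (a - b₁ - b₂ - 1) * (((Q.1 * t) ^ b₁ * laplaceBeta b₁ (Q.1 * t)) *
        ((Q.2 * t) ^ b₂ * laplaceBeta b₂ (Q.2 * t)))) (atTop ×ˢ atTop)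
      (𝓝 (∫ t in Ioi (0 : ℝ), Real.exp (-t) * t ^ (a - b₁ - b₂ - 1) *
        (Real.Gamma b₁ / beta b₁ b₁ * (Real.Gamma b₂ / beta b₂ b₂)))) := by
    refine tendsto_integral_filter_of_dominated_convergence
      (fun t => Real.exp (-t) * t ^ (a - b₁ - b₂ - 1) * (C₁ * C₂)) ?_ ?_
      ((Real.GammaIntegral_convergent hab).mul_const _) ?_
    · exact Eventually.of_forall fun Q => Measurable.aestronglyMeasurable (by fun_prop)
    · filter_upwards [hpos] with Q hQ
      refine ae_restrict_of_forall_mem measurableSet_Ioi fun t ht => ?_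
      have ht0 : 0 < t := ht
      have p1 := mul_pos hQ.1 ht0
      have p2 := mul_pos hQ.2 ht0
      have q1 := hN₁ _ p1
      have q2 := hN₂ _ p2
      rw [Real.norm_of_nonneg (mul_nonneg (by positivity) (mul_nonneg q1 q2))]
      exact mul_le_mul_of_nonneg_left (mul_le_mul (hC₁ _ p1) (hC₂ _ p2) q2
        (q1.trans (hC₁ _ p1))) (by positivity)
    · refine ae_restrict_of_forall_mem measurableSet_Ioi fun t ht => ?_
      have ht0 : 0 < t := ht
      have t1 : Tendsto (fun Q : ℝ × ℝ => Q.1 * t) (atTop ×ˢ atTop) atTop :=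
        tendsto_fst.atTop_mul_const ht0
      have t2 : Tendsto (fun Q : ℝ × ℝ => Q.2 * t) (atTop ×ˢ atTop) atTop :=
        tendsto_snd.atTop_mul_const ht0
      exact (((tendsto_rpow_mul_laplaceBeta h₁ h₁').comp t1).mul
        ((tendsto_rpow_mul_laplaceBeta h₂ h₂').comp t2)).const_mul _
  rw [integral_mul_const, ← Real.Gamma_eq_integral hab] at hlim
  refine (hlim.const_mul (1 / Real.Gamma a)).congr' ?_
  filter_upwards [hpos] with Q hQ
  rw [powerAverage_eq_integral_laplaceBeta (by linarith) h₁ h₂ hQ.1.le hQ.2.le, mul_left_comm,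
    ← integral_const_mul (Q.1 ^ b₁ * Q.2 ^ b₂)]
  congr 1
  refine setIntegral_congr_fun measurableSet_Ioi fun t ht => ?_
  have ht0 : 0 < t := ht
  rw [Real.mul_rpow hQ.1.le ht0.le, Real.mul_rpow hQ.2.le ht0.le,
    show a - 1 = (a - b₁ - b₂ - 1) + b₁ + b₂ by ring, Real.rpow_add ht0, Real.rpow_add ht0]
  ring

/-! ### Asymptotics of the function `A₂` -/

theorem integrable_power_betaProd {b₁ b₂ X Y : ℝ} (h₁ : 0 < b₁) (h₂ : 0 < b₂) (hX : 0 ≤ X)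
    (hY : 0 ≤ Y) {e : ℝ} (he : 0 ≤ e) :
    Integrable (fun q : ℝ × ℝ => (1 + X * q.1 + Y * q.2) ^ (-e)) (betaProd b₁ b₂) := by
  have := isProbabilityMeasure_betaProd h₁ h₂
  refine Integrable.of_bound (Measurable.aestronglyMeasurable (by fun_prop)) 1 ?_
  filter_upwards [ae_betaProd_mem h₁ h₂] with q hq
  have h3 := mul_nonneg hX hq.1.1
  have h4 := mul_nonneg hY hq.2.1
  rw [Real.norm_of_nonneg (Real.rpow_nonneg (by linarith) _)]
  exact Real.rpow_le_one_of_one_le_of_nonpos (by linarith) (by linarith)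

/-- For small `ρ`, the confluent factor changes the average of the power by an amount of smaller
order: it costs a factor `ρ ^ θ`, at the price of the exponent `θ` in the power. -/
theorem exists_norm_integralA2_sub_powerAverage_le {a b₁ b₂ θ S : ℝ} (ha : 0 < a) (h₁ : 0 < b₁)
    (h₂ : 0 < b₂) (hθ₀ : 0 < θ) (hθ₁ : θ < 1) (hθa : θ ≤ a) (c : ℂ) :
    ∃ K, ∀ ρ A B : ℝ, 0 < ρ → 0 ≤ A → 0 ≤ B → ρ + A + B ≤ S →
      ‖integralA2 a b₁ b₂ (c * ρ) (((-(A / ρ) : ℝ) : ℂ), ((-(B / ρ) : ℝ) : ℂ)) -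
        (powerAverage a b₁ b₂ (A / ρ) (B / ρ) : ℝ)‖ ≤
        K * (ρ ^ θ * powerAverage (a - θ) b₁ b₂ (A / ρ) (B / ρ)) := by
  have := isProbabilityMeasure_betaProd h₁ h₂
  have hΓ : Complex.Gamma (a : ℂ) ≠ 0 := by
    rw [Complex.Gamma_ofReal]
    exact_mod_cast (Real.Gamma_pos_of_pos ha).ne'
  obtain ⟨K, hK₀, hK⟩ := exists_norm_confluentFun_sub_one_le hΓ (‖c‖ * S)
  refine ⟨K * ‖c‖ * S ^ (1 - θ), fun ρ A B hρ hA hB hS => ?_⟩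
  have hX : 0 ≤ A / ρ := by positivity
  have hY : 0 ≤ B / ρ := by positivity
  have hbound : ∀ᵐ q ∂betaProd b₁ b₂,
      ‖kernelA2 a (c * ρ) (1 - (((-(A / ρ) : ℝ) : ℂ) * (q.1 : ℝ) +
        ((-(B / ρ) : ℝ) : ℂ) * (q.2 : ℝ))) -
          (((1 + A / ρ * q.1 + B / ρ * q.2) ^ (-a) : ℝ) : ℂ)‖ ≤
        K * ‖c‖ * S ^ (1 - θ) * (ρ ^ θ * (1 + A / ρ * q.1 + B / ρ * q.2) ^ (-(a - θ))) := by
    filter_upwards [ae_betaProd_mem h₁ h₂] with q hq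
    have h3 := mul_nonneg hX hq.1.1
    have h4 := mul_nonneg hY hq.2.1
    have hρw : ρ * (1 + A / ρ * q.1 + B / ρ * q.2) = ρ + A * q.1 + B * q.2 := by field_simp
    have hw' : ρ + A * q.1 + B * q.2 ≤ S := by
      have := mul_le_of_le_one_right hA hq.1.2
      have := mul_le_of_le_one_right hB hq.2.2
      linarith
    have e1 : 1 - (((-(A / ρ) : ℝ) : ℂ) * (q.1 : ℝ) + ((-(B / ρ) : ℝ) : ℂ) * (q.2 : ℝ)) =
        ((1 + A / ρ * q.1 + B / ρ * q.2 : ℝ) : ℂ) := by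
      push_cast
      ring
    rw [e1]
    have hw1 : 1 ≤ 1 + A / ρ * q.1 + B / ρ * q.2 := by linarith
    generalize 1 + A / ρ * q.1 + B / ρ * q.2 = w at *
    have hw0 : 0 < w := by linarith
    rw [← hρw] at hw'
    have hn : ‖c * ρ * (w : ℂ)‖ = ‖c‖ * (ρ * w) := by
      rw [norm_mul, norm_mul, Complex.norm_real, Complex.norm_real, Real.norm_of_nonneg hρ.le,
        Real.norm_of_nonneg hw0.le, mul_assoc]
    have hd := hK (c * ρ * (w : ℂ)) (by rw [hn]; gcongr)
    rw [hn] at hd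
    have e2 : kernelA2 a (c * ρ) (w : ℂ) - ((w ^ (-a) : ℝ) : ℂ) =
        ((w ^ (-a) : ℝ) : ℂ) * (confluentFun a (c * ρ * (w : ℂ)) - 1) := by
      rw [kernelA2, Complex.ofReal_cpow hw0.le]
      push_cast
      ring
    have h5 : ρ * w ≤ S ^ (1 - θ) * (ρ ^ θ * w ^ θ) := by
      have hp : 0 < ρ * w := by positivity
      rw [← Real.mul_rpow hρ.le hw0.le]
      calc ρ * w = (ρ * w) ^ (1 - θ) * (ρ * w) ^ θ := by
            rw [← Real.rpow_add hp, sub_add_cancel, Real.rpow_one]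
        _ ≤ _ := by
          gcongr
    rw [e2, norm_mul, Complex.norm_real, Real.norm_of_nonneg (by positivity)]
    calc w ^ (-a) * ‖confluentFun a (c * ρ * (w : ℂ)) - 1‖
        ≤ w ^ (-a) * (K * (‖c‖ * (S ^ (1 - θ) * (ρ ^ θ * w ^ θ)))) := by
          gcongr
          exact hd.trans (by gcongr)
      _ = K * ‖c‖ * S ^ (1 - θ) * (ρ ^ θ * w ^ (-(a - θ))) := by
          rw [show -(a - θ) = -a + θ by ring, Real.rpow_add hw0]
          ring
  have hI1 := integrable_power_betaProd h₁ h₂ hX hY ha.le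
  have hI1c : Integrable (fun q : ℝ × ℝ => (((1 + A / ρ * q.1 + B / ρ * q.2) ^ (-a) : ℝ) : ℂ))
      (betaProd b₁ b₂) := hI1.ofReal
  have hI2 := integrable_power_betaProd h₁ h₂ hX hY (sub_nonneg.2 hθa)
  have hmeas : AEStronglyMeasurable (fun q : ℝ × ℝ => kernelA2 a (c * ρ)
      (1 - (((-(A / ρ) : ℝ) : ℂ) * (q.1 : ℝ) + ((-(B / ρ) : ℝ) : ℂ) * (q.2 : ℝ))))
      (betaProd b₁ b₂) := by
    have hc := (differentiable_confluentFun a).continuous.measurable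
    unfold kernelA2
    exact Measurable.aestronglyMeasurable (by fun_prop)
  have hI4 := (hI2.const_mul (ρ ^ θ)).const_mul (K * ‖c‖ * S ^ (1 - θ))
  have hI3 : Integrable (fun q : ℝ × ℝ => kernelA2 a (c * ρ)
      (1 - (((-(A / ρ) : ℝ) : ℂ) * (q.1 : ℝ) + ((-(B / ρ) : ℝ) : ℂ) * (q.2 : ℝ))) -
        (((1 + A / ρ * q.1 + B / ρ * q.2) ^ (-a) : ℝ) : ℂ)) (betaProd b₁ b₂) :=
    hI4.mono' (hmeas.sub hI1c.aestronglyMeasurable) hbound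
  have hI5 : Integrable (fun q : ℝ × ℝ => kernelA2 a (c * ρ)
      (1 - (((-(A / ρ) : ℝ) : ℂ) * (q.1 : ℝ) + ((-(B / ρ) : ℝ) : ℂ) * (q.2 : ℝ))))
      (betaProd b₁ b₂) :=
    (hI3.add hI1c).congr (Eventually.of_forall fun q => sub_add_cancel _ _)
  rw [integralA2, powerAverage, ← integral_complex_ofReal]
  dsimp only
  rw [← integral_sub hI5 hI1c]
  refine (norm_integral_le_of_norm_le hI4 hbound).trans_eq ?_
  rw [integral_const_mul, integral_const_mul, powerAverage]

/-- The exact order of `A₂` near the singularity: with `ξ = -A / ρ`, `η = -B / ρ` and `ζ = c ρ`, it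
is `ρ ^ (b₁ + b₂)` as `ρ → 0`. -/
theorem exists_tendsto_rpow_mul_integralA2 {a b₁ b₂ : ℝ} (h₁ : 0 < b₁) (h₁' : b₁ < 1) (h₂ : 0 < b₂)
    (h₂' : b₂ < 1) (ha : b₁ + b₂ < a) (c : ℂ) {ι : Type*} {l : Filter ι} {ρ A B : ι → ℝ}
    {A₀ B₀ : ℝ} (hA₀ : 0 < A₀) (hB₀ : 0 < B₀) (hρ : Tendsto ρ l (𝓝[>] 0))
    (hA : Tendsto A l (𝓝 A₀)) (hB : Tendsto B l (𝓝 B₀)) :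
    ∃ L : ℂ, L ≠ 0 ∧ Tendsto (fun i => ((ρ i ^ (-(b₁ + b₂)) : ℝ) : ℂ) *
      integralA2 a b₁ b₂ (c * ρ i) (((-(A i / ρ i) : ℝ) : ℂ), ((-(B i / ρ i) : ℝ) : ℂ)))
      l (𝓝 L) := by
  obtain ⟨hρ0, hρpos⟩ := tendsto_nhdsWithin_iff.1 hρ
  have hρinv : Tendsto (fun i => (ρ i)⁻¹) l atTop := tendsto_inv_nhdsGT_zero.comp hρ
  have hX : Tendsto (fun i => A i / ρ i) l atTop := by
    simpa only [div_eq_mul_inv] using hA.pos_mul_atTop hA₀ hρinv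
  have hY : Tendsto (fun i => B i / ρ i) l atTop := by
    simpa only [div_eq_mul_inv] using hB.pos_mul_atTop hB₀ hρinv
  have hApos := hA.eventually (lt_mem_nhds hA₀)
  have hBpos := hB.eventually (lt_mem_nhds hB₀)
  have hAB : Tendsto (fun i => A i ^ (-b₁) * B i ^ (-b₂)) l (𝓝 (A₀ ^ (-b₁) * B₀ ^ (-b₂))) :=
    (hA.rpow_const (Or.inl hA₀.ne')).mul (hB.rpow_const (Or.inl hB₀.ne'))
  have hpow : ∀ e, b₁ + b₂ < e → ∃ M, 0 < M ∧ Tendsto (fun i => ρ i ^ (-(b₁ + b₂)) *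
      powerAverage e b₁ b₂ (A i / ρ i) (B i / ρ i)) l (𝓝 M) := by
    intro e he
    have h := hAB.mul ((tendsto_rpow_mul_powerAverage h₁ h₁' h₂ h₂' he).comp (hX.prodMk hY))
    refine ⟨_, ?_, h.congr' ?_⟩
    · have g1 := Real.Gamma_pos_of_pos (show 0 < e by linarith)
      have g2 := Real.Gamma_pos_of_pos (show 0 < e - b₁ - b₂ by linarith)
      have g3 := Real.Gamma_pos_of_pos h₁
      have g4 := Real.Gamma_pos_of_pos h₂
      have g5 := beta_pos h₁ h₁
      have g6 := beta_pos h₂ h₂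
      positivity
    · filter_upwards [hApos, hBpos, hρpos] with i hAi hBi hρi
      have hρi' : 0 < ρ i := hρi
      simp only [Function.comp_apply]
      rw [Real.div_rpow hAi.le hρi'.le, Real.div_rpow hBi.le hρi'.le, neg_add,
        Real.rpow_add hρi', Real.rpow_neg hAi.le, Real.rpow_neg hBi.le, Real.rpow_neg hρi'.le,
        Real.rpow_neg hρi'.le]
      have := Real.rpow_pos_of_pos hAi b₁
      have := Real.rpow_pos_of_pos hBi b₂
      field_simp
  -- any `θ < 1` with `a - θ > b₁ + b₂` keeps the average in the error term of the same order
  obtain ⟨θ, hθ₀, hθ⟩ := exists_between (show 0 < min 1 (a - b₁ - b₂) from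
    lt_min one_pos (by linarith))
  have hθ₁ : θ < 1 := hθ.trans_le (min_le_left _ _)
  have hθa : θ < a - b₁ - b₂ := hθ.trans_le (min_le_right _ _)
  obtain ⟨M, hM, hMt⟩ := hpow a ha
  obtain ⟨N, -, hNt⟩ := hpow (a - θ) (by linarith)
  obtain ⟨K, hK⟩ := exists_norm_integralA2_sub_powerAverage_le (S := A₀ + B₀ + 1)
    (show 0 < a by linarith) h₁ h₂ hθ₀ hθ₁ (by linarith) c
  have hS : ∀ᶠ i in l, ρ i + A i + B i < A₀ + B₀ + 1 :=
    ((hρ0.add hA).add hB).eventually (gt_mem_nhds (by linarith))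
  have herr : Tendsto (fun i => K * (ρ i ^ θ * (ρ i ^ (-(b₁ + b₂)) *
      powerAverage (a - θ) b₁ b₂ (A i / ρ i) (B i / ρ i)))) l (𝓝 0) := by
    have h := (((hρ0.rpow_const (p := θ) (Or.inr hθ₀.le)).mul hNt).const_mul K)
    rwa [Real.zero_rpow hθ₀.ne', zero_mul, mul_zero] at h
  refine ⟨M, by exact_mod_cast hM.ne', ?_⟩
  have hdiff : Tendsto (fun i => ((ρ i ^ (-(b₁ + b₂)) : ℝ) : ℂ) *
      (integralA2 a b₁ b₂ (c * ρ i) (((-(A i / ρ i) : ℝ) : ℂ), ((-(B i / ρ i) : ℝ) : ℂ)) -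
        (powerAverage a b₁ b₂ (A i / ρ i) (B i / ρ i) : ℝ))) l (𝓝 0) := by
    refine squeeze_zero_norm' ?_ herr
    filter_upwards [hApos, hBpos, hρpos, hS] with i hAi hBi hρi hSi
    have hρi' : 0 < ρ i := hρi
    rw [norm_mul, Complex.norm_real, Real.norm_of_nonneg (by positivity)]
    calc _ ≤ ρ i ^ (-(b₁ + b₂)) * (K * (ρ i ^ θ *
          powerAverage (a - θ) b₁ b₂ (A i / ρ i) (B i / ρ i))) := by
          gcongr
          exact hK _ _ _ hρi' hAi.le hBi.le hSi.le
      _ = _ := by ring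
  have hmain := (Complex.continuous_ofReal.tendsto M).comp hMt
  have h := hdiff.add hmain
  rw [zero_add] at h
  refine h.congr fun i => ?_
  simp only [Function.comp_apply]
  push_cast
  ring

/-! ### The fundamental solutions -/

theorem hypergeometricA2_eq_integralA2 {a b₁ b₂ : ℝ} (ha : 0 < a) (h₁ : 0 < b₁) (h₂ : 0 < b₂)
    {z : ℂ} (hz : z = 0 ∨ ∀ n : ℕ, 1 ≤ n → a ≠ n) {w : ℂ × ℂ} (hw : w ∈ domainA2) :
    hypergeometricA2 a b₁ b₂ ((2 * b₁ : ℝ) : ℂ) ((2 * b₂ : ℝ) : ℂ) w.1 w.2 z =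
      integralA2 a b₁ b₂ z w := by
  have hI := isContinuationA2_integralA2 ha h₁ h₂ hz
  have hex : ∃ f, IsContinuationA2 a b₁ b₂ ((2 * b₁ : ℝ) : ℂ) ((2 * b₂ : ℝ) : ℂ) z f := ⟨_, hI⟩
  rw [hypergeometricA2, dif_pos hex]
  exact hex.choose_spec.eqOn hI hw

theorem zetaVar_eq_zero_or {p : ℕ} {lam : ℂ} {a : ℝ} (h : lam = 0 ∨ ∀ n : ℕ, 1 ≤ n → a ≠ n)
    (x x₀ : EuclideanSpace ℝ (Fin p)) : zetaVar lam x x₀ = 0 ∨ ∀ n : ℕ, 1 ≤ n → a ≠ n :=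
  h.imp_left fun h => by simp [zetaVar, h]

theorem a2WellDefined_of_pos {p : ℕ} {lam : ℂ} {a b₁ b₂ : ℝ} (ha : 0 < a) (h₁ : 0 < b₁)
    (h₂ : 0 < b₂) (h : lam = 0 ∨ ∀ n : ℕ, 1 ≤ n → a ≠ n) :
    A2WellDefined p lam a b₁ b₂ (2 * b₁) (2 * b₂) := by
  intro x x₀
  have hex : ∃ f, IsContinuationA2 a b₁ b₂ ((2 * b₁ : ℝ) : ℂ) ((2 * b₂ : ℝ) : ℂ)
      (zetaVar lam x x₀) f :=
    ⟨_, isContinuationA2_integralA2 ha h₁ h₂ (zetaVar_eq_zero_or h x x₀)⟩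
  simp only [hypergeometricA2, dif_pos hex]
  exact hex.choose_spec

theorem rSq_eq_dist_sq {p : ℕ} (x x₀ : EuclideanSpace ℝ (Fin p)) : rSq x x₀ = dist x x₀ ^ 2 := by
  rw [EuclideanSpace.dist_eq, Real.sq_sqrt (Finset.sum_nonneg fun i _ => sq_nonneg _)]
  simp [rSq, Real.dist_eq]

theorem ratioVar_eq {p : ℕ} (j : Fin p) (x x₀ : EuclideanSpace ℝ (Fin p)) :
    ratioVar j x x₀ = -(4 * x j * x₀ j / rSq x x₀) := by
  have h : rSq x x₀ - reflectedRSq j x x₀ = -(4 * x j * x₀ j) := by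
    rw [rSq, reflectedRSq, ← Finset.add_sum_erase _ _ (Finset.mem_univ j)]
    ring
  rw [ratioVar, h, neg_div]

/-- The common form of the four fundamental solutions: `b₁` is `α` or `1 - α`, and `b₂` is `β` or
`1 - β`. -/
theorem hasSingularityOfOrder_of_eq {p : ℕ} (hp : 2 < p) {a b₁ b₂ e₁ e₂ : ℝ} (h₁ : 0 < b₁)
    (h₁' : b₁ < 1) (h₂ : 0 < b₂) (h₂' : b₂ < 1) (ha : a = b₁ + b₂ - 1 + (p : ℝ) / 2) {lam k : ℂ}
    (hk : k ≠ 0) (h : lam = 0 ∨ ∀ n : ℕ, 1 ≤ n → a ≠ n) {x₀ : EuclideanSpace ℝ (Fin p)}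
    (hx₁ : 0 < x₀ (ix1 hp)) (hx₂ : 0 < x₀ (ix2 hp)) {u : EuclideanSpace ℝ (Fin p) → ℂ}
    (hu : ∀ x, u x = k * (rSq x x₀ ^ (-a) * (x (ix1 hp) ^ e₁ * x₀ (ix1 hp) ^ e₁) *
      (x (ix2 hp) ^ e₂ * x₀ (ix2 hp) ^ e₂) : ℝ) *
        A2xi hp lam a b₁ b₂ (2 * b₁) (2 * b₂) x x₀) :
    HasSingularityOfOrder u x₀ (p - 2) := by
  have hp' : (2 : ℝ) < p := by exact_mod_cast hp
  have hab : b₁ + b₂ < a := by linarith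
  have hcoord : ∀ j : Fin p, Tendsto (fun x : EuclideanSpace ℝ (Fin p) => x j) (𝓝[≠] x₀)
      (𝓝 (x₀ j)) := fun j =>
    ((by fun_prop : Continuous fun x : EuclideanSpace ℝ (Fin p) => x j).tendsto x₀).mono_left
      nhdsWithin_le_nhds
  have hne : ∀ᶠ x in 𝓝[≠] x₀, 0 < dist x x₀ := by
    filter_upwards [self_mem_nhdsWithin] with x hx
    exact dist_pos.2 hx
  have hρ : Tendsto (fun x => rSq x x₀) (𝓝[≠] x₀) (𝓝[>] 0) := by
    refine tendsto_nhdsWithin_iff.2 ⟨?_, ?_⟩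
    · simp only [rSq_eq_dist_sq]
      have : Continuous fun x : EuclideanSpace ℝ (Fin p) => dist x x₀ ^ 2 := by fun_prop
      simpa using (this.tendsto x₀).mono_left nhdsWithin_le_nhds
    · filter_upwards [hne] with x hx
      rw [rSq_eq_dist_sq]
      exact pow_pos hx 2
  obtain ⟨L, hL, hLt⟩ := exists_tendsto_rpow_mul_integralA2 h₁ h₁' h₂ h₂' hab (-(lam ^ 2 / 4))
    (A := fun x => 4 * x (ix1 hp) * x₀ (ix1 hp)) (B := fun x => 4 * x (ix2 hp) * x₀ (ix2 hp))
    (A₀ := 4 * x₀ (ix1 hp) * x₀ (ix1 hp)) (B₀ := 4 * x₀ (ix2 hp) * x₀ (ix2 hp))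
    (by positivity) (by positivity) hρ (((hcoord _).const_mul 4).mul_const _)
    (((hcoord _).const_mul 4).mul_const _)
  have hP : Tendsto (fun x : EuclideanSpace ℝ (Fin p) => (x (ix1 hp) ^ e₁ * x₀ (ix1 hp) ^ e₁) *
      (x (ix2 hp) ^ e₂ * x₀ (ix2 hp) ^ e₂)) (𝓝[≠] x₀) (𝓝 ((x₀ (ix1 hp) ^ e₁ * x₀ (ix1 hp) ^ e₁) *
      (x₀ (ix2 hp) ^ e₂ * x₀ (ix2 hp) ^ e₂))) :=
    (((hcoord _).rpow_const (Or.inl hx₁.ne')).mul_const _).mul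
      (((hcoord _).rpow_const (Or.inl hx₂.ne')).mul_const _)
  have hPt := ((Complex.continuous_ofReal.tendsto _).comp hP).const_mul k
  refine ⟨_, ?_, (hPt.mul hLt).congr' ?_⟩
  · refine mul_ne_zero (mul_ne_zero hk ?_) hL
    exact Complex.ofReal_ne_zero.2 (by positivity)
  · filter_upwards [hne, (hcoord (ix1 hp)).eventually (lt_mem_nhds hx₁),
      (hcoord (ix2 hp)).eventually (lt_mem_nhds hx₂)] with x hx hx1 hx2
    have hr : 0 < rSq x x₀ := by
      rw [rSq_eq_dist_sq]
      exact pow_pos hx 2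
    have hneg : ∀ t : ℝ, 0 < t → -(t / rSq x x₀) < 1 / 2 := fun t ht => by
      have := div_pos ht hr
      linarith
    have hmem : (((ratioVar (ix1 hp) x x₀ : ℝ) : ℂ), ((ratioVar (ix2 hp) x x₀ : ℝ) : ℂ)) ∈
        domainA2 := by
      simp only [domainA2, Set.mem_ofPred_eq, Complex.ofReal_re, ratioVar_eq]
      exact ⟨hneg _ (by positivity), hneg _ (by positivity)⟩
    have hA2 := hypergeometricA2_eq_integralA2 (show 0 < a by linarith) h₁ h₂
      (zetaVar_eq_zero_or h x x₀) hmem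
    -- `r^(p-2) (r²)^(-a) = (r²)^(-(b₁+b₂))`
    have hpw : dist x x₀ ^ (p - 2) * rSq x x₀ ^ (-a) = rSq x x₀ ^ (-(b₁ + b₂)) := by
      rw [rSq_eq_dist_sq, ← Real.rpow_natCast, ← Real.rpow_natCast, ← Real.rpow_mul hx.le,
        ← Real.rpow_mul hx.le, ← Real.rpow_add hx, Nat.cast_sub hp.le, ha]
      congr 1
      push_cast
      ring
    rw [hu, A2xi, hA2, ← hpw, ratioVar_eq, ratioVar_eq, zetaVar]
    simp only [Function.comp_apply]
    push_cast
    ring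

end

theorem mainTheorem3 {p : ℕ} (hp : 2 < p) (α β : ℝ) (lam : ℂ)
    (hα₀ : 0 < 2 * α) (hα₁ : 2 * α < 1) (hβ₀ : 0 < 2 * β) (hβ₁ : 2 * β < 1)
    (k₁ k₂ k₃ k₄ : ℂ) (hk₁ : k₁ ≠ 0) (hk₂ : k₂ ≠ 0) (hk₃ : k₃ ≠ 0) (hk₄ : k₄ ≠ 0)
    (x₀ : EuclideanSpace ℝ (Fin p)) (hx₁ : 0 < x₀ (ix1 hp)) (hx₂ : 0 < x₀ (ix2 hp)) :
    ((lam = 0 ∨ ∀ n : ℕ, 1 ≤ n → α + β - 1 + (p : ℝ) / 2 ≠ n) →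
      A2WellDefined p lam (α + β - 1 + (p : ℝ) / 2) α β (2 * α) (2 * β) ∧
      HasSingularityOfOrder (fun x => fundSol1 hp α β lam k₁ x x₀) x₀ (p - 2)) ∧
    ((lam = 0 ∨ ∀ n : ℕ, 1 ≤ n → -α + β + (p : ℝ) / 2 ≠ n) →
      A2WellDefined p lam (-α + β + (p : ℝ) / 2) (1 - α) β (2 - 2 * α) (2 * β) ∧
      HasSingularityOfOrder (fun x => fundSol2 hp α β lam k₂ x x₀) x₀ (p - 2)) ∧
    ((lam = 0 ∨ ∀ n : ℕ, 1 ≤ n → α - β + (p : ℝ) / 2 ≠ n) →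
      A2WellDefined p lam (α - β + (p : ℝ) / 2) α (1 - β) (2 * α) (2 - 2 * β) ∧
      HasSingularityOfOrder (fun x => fundSol3 hp α β lam k₃ x x₀) x₀ (p - 2)) ∧
    ((lam = 0 ∨ ∀ n : ℕ, 1 ≤ n → 1 - α - β + (p : ℝ) / 2 ≠ n) →
      A2WellDefined p lam (1 - α - β + (p : ℝ) / 2) (1 - α) (1 - β) (2 - 2 * α) (2 - 2 * β) ∧
      HasSingularityOfOrder (fun x => fundSol4 hp α β lam k₄ x x₀) x₀ (p - 2)) := by
  have hp' : (2 : ℝ) < p := by exact_mod_cast hp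
  refine ⟨fun h => ?_, fun h => ?_, fun h => ?_, fun h => ?_⟩
  · refine ⟨a2WellDefined_of_pos (by linarith) (by linarith) (by linarith) h,
      hasSingularityOfOrder_of_eq hp (b₁ := α) (b₂ := β) (e₁ := 0) (e₂ := 0) (by linarith)
        (by linarith) (by linarith) (by linarith) (by ring) hk₁ h hx₁ hx₂ fun x => ?_⟩
    simp only [fundSol1, Real.rpow_zero, mul_one]
    rw [show 1 - α - β - (p : ℝ) / 2 = -(α + β - 1 + (p : ℝ) / 2) by ring]
  · rw [show 2 - 2 * α = 2 * (1 - α) by ring]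
    refine ⟨a2WellDefined_of_pos (by linarith) (by linarith) (by linarith) h,
      hasSingularityOfOrder_of_eq hp (b₁ := 1 - α) (b₂ := β) (e₁ := 1 - 2 * α) (e₂ := 0)
        (by linarith) (by linarith) (by linarith) (by linarith) (by ring) hk₂ h hx₁ hx₂
        fun x => ?_⟩
    simp only [fundSol2, Real.rpow_zero, mul_one]
    rw [show α - β - (p : ℝ) / 2 = -(-α + β + (p : ℝ) / 2) by ring,
      show 2 - 2 * α = 2 * (1 - α) by ring, mul_assoc (_ ^ _)]
  · rw [show 2 - 2 * β = 2 * (1 - β) by ring]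
    refine ⟨a2WellDefined_of_pos (by linarith) (by linarith) (by linarith) h,
      hasSingularityOfOrder_of_eq hp (b₁ := α) (b₂ := 1 - β) (e₁ := 0) (e₂ := 1 - 2 * β)
        (by linarith) (by linarith) (by linarith) (by linarith) (by ring) hk₃ h hx₁ hx₂
        fun x => ?_⟩
    simp only [fundSol3, Real.rpow_zero, mul_one]
    rw [show -α + β - (p : ℝ) / 2 = -(α - β + (p : ℝ) / 2) by ring,
      show 2 - 2 * β = 2 * (1 - β) by ring, mul_assoc (_ ^ _)]
  · rw [show 2 - 2 * α = 2 * (1 - α) by ring, show 2 - 2 * β = 2 * (1 - β) by ring]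
    refine ⟨a2WellDefined_of_pos (by linarith) (by linarith) (by linarith) h,
      hasSingularityOfOrder_of_eq hp (b₁ := 1 - α) (b₂ := 1 - β) (e₁ := 1 - 2 * α)
        (e₂ := 1 - 2 * β) (by linarith) (by linarith) (by linarith) (by linarith) (by ring) hk₄ h
        hx₁ hx₂ fun x => ?_⟩
    simp only [fundSol4]
    rw [show -1 + α + β - (p : ℝ) / 2 = -(1 - α - β + (p : ℝ) / 2) by ring,
      show 2 - 2 * α = 2 * (1 - α) by ring, show 2 - 2 * β = 2 * (1 - β) by ring]
    simp only [mul_assoc]
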